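/- Let $(X_i)_{i\ge 1}$ be i.i.d. real random variables with a Lebesgue density $f$, let $\ell\ge 1$, and suppose that $f\in W^{\ell,1}$, i.e. $f$ and its weak derivatives $f^{(1)},\dots,f^{(\ell)}$ are in $L_1(\mathbb R)$. Let $K:\mathbb R\to\mathbb R$ be a kernel of order $\ell$: $u^jK(u)\in L_1(\mathbb R)$ for $0\le j\le \ell$, $\int K=1$, $\int u^jK(u)\,du=0$ for $1\le j\le \ell-1$, and $\int u^\ell K(u)\,du\neq 0$. Let $F_n$ be the empirical distribution function of $X_1,\dots,X_n$ and, for $h>0$, let $$\hat F_n^h(x)=\int_{-\infty}^x \frac1{nh}\sum_{i=1}^n K\Big(\frac{t-X_i}{h}\Big)\,dt .$$ Let $d$ be the Kolmogorov distance $d(F,G)=\sup_x|F(x)-G(x)|$ or, for some $k\ge 1$, the $k$-th order Kuiper distance $$d(F,G)=\sup_{a_1\le b_1\le\dots\le a_k\le b_k}\ \sum_{i=1}^k\big|(F(b_i)-F(a_i))-(G(b_i)-G(a_i))\big| .$$ Let $s:\mathbb N\to\mathbb R$ satisfy $s(n)=O\big(\sqrt{\log\log n/n}\big)$. Then almost surely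 every choice of bandwidths $h_{s,n}>0$ solving the discrepancy equation $d(F_n,\hat F_n^{h_{s,n}})=s(n)$ satisfies $$h_{s,n}=O\big(n^{-1/(2\ell)}(\log\log n)^{1/(2\ell)}\big)\qquad(n\to\infty).$$ More precisely, almost surely there are (random) $C$ and $N$ such that for all $n\ge N$ every solution $h>0$ of $d(F_n,\hat F_n^h)=s(n)$ satisfies $h\le C\,n^{-1/(2\ell)}(\log\log n)^{1/(2\ell)}$. In particular, almost surely, $h_{s,n}=o\big(n^{-1/(2\ell+1)}\big)$, again uniformly over all solutions; that is, the discrepancy principle with such a threshold (for instance $s(n)=c\,n^{-1/2}$ with $c$ a fixed quantile of $\sqrt n\,d(F_n,F)$) asymptotically undersmooths compared with the usual optimal order $n^{-1/(2\ell+1)}$. -/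

import Mathlib

open MeasureTheory ProbabilityTheory Filter Topology Asymptotics

noncomputable section

namespace KernelDiscrepancy

/-- `g` is the weak derivative of order `j` of `f` on the real line. -/
def IsWeakDeriv (j : ℕ) (f g : ℝ → ℝ) : Prop :=
  ∀ φ : ℝ → ℝ, ContDiff ℝ ((⊤ : ℕ∞) : WithTop ℕ∞) φ → HasCompactSupport φ →
    ∫ x, f x * iteratedDeriv j φ x = (-1) ^ j * ∫ x, g x * φ x

/-- `f` belongs to the Sobolev space `W^{ℓ,1}` of the real line: `f` and its weak derivatives
up to order `ℓ` are integrable. -/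
def MemSobolevL1 (ℓ : ℕ) (f : ℝ → ℝ) : Prop :=
  Integrable f ∧ ∀ j, j ≤ ℓ → ∃ g : ℝ → ℝ, Integrable g ∧ IsWeakDeriv j f g

/-- `K` is a kernel of order `ℓ`. -/
structure IsKernelOfOrder (K : ℝ → ℝ) (ℓ : ℕ) : Prop where
  integrable_moment : ∀ j, j ≤ ℓ → Integrable (fun u : ℝ => u ^ j * K u)
  integral_eq_one : ∫ u, K u = 1
  moment_eq_zero : ∀ j, 1 ≤ j → j < ℓ → ∫ u, u ^ j * K u = 0
  moment_ne_zero : ∫ u, u ^ ℓ * K u ≠ 0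

/-- The empirical distribution function of the sample `x 0, …, x (n - 1)`. -/
def empiricalCDF (x : ℕ → ℝ) (n : ℕ) (t : ℝ) : ℝ :=
  (n : ℝ)⁻¹ * ∑ i ∈ Finset.range n, (Set.Iic t).indicator (fun _ => (1 : ℝ)) (x i)

/-- The kernel density estimator with bandwidth `h`, for the sample `x 0, …, x (n - 1)`. -/
def kernelDensityEstimator (K : ℝ → ℝ) (x : ℕ → ℝ) (n : ℕ) (h t : ℝ) : ℝ :=
  ((n : ℝ) * h)⁻¹ * ∑ i ∈ Finset.range n, K ((t - x i) / h)

/-- The kernel estimator of the distribution function with bandwidth `h`. -/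
def kernelCDFEstimator (K : ℝ → ℝ) (x : ℕ → ℝ) (n : ℕ) (h t : ℝ) : ℝ :=
  ∫ u in Set.Iic t, kernelDensityEstimator K x n h u

/-- The Kolmogorov distance (used for bounded functions only). -/
def kolmogorovDist (F G : ℝ → ℝ) : ℝ := ⨆ t : ℝ, |F t - G t|

/-- The `k`-th order Kuiper distance (used for bounded functions only): the supremum over all
`a₁ ≤ b₁ ≤ a₂ ≤ b₂ ≤ … ≤ a_k ≤ b_k`. -/
def kuiperDist (k : ℕ) (F G : ℝ → ℝ) : ℝ :=
  sSup {r : ℝ | ∃ a b : Fin k → ℝ, (∀ i, a i ≤ b i) ∧ (∀ i j, i < j → b i ≤ a j) ∧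
    r = ∑ i, |(F (b i) - F (a i)) - (G (b i) - G (a i))|}

/-- The distances in use: the Kolmogorov distance and the Kuiper distances of order `k ≥ 1`. -/
def IsDiscrepancyDist (d : (ℝ → ℝ) → (ℝ → ℝ) → ℝ) : Prop :=
  d = kolmogorovDist ∨ ∃ k : ℕ, 1 ≤ k ∧ d = kuiperDist k

/-- `h` is a bandwidth chosen by the discrepancy principle with distance `d` and threshold `τ`
for the sample `x 0, …, x (n - 1)`: a positive solution of `d (F_n, F̂_n^h) = τ`. -/
def IsDiscrepancyBandwidth (d : (ℝ → ℝ) → (ℝ → ℝ) → ℝ) (K : ℝ → ℝ) (x : ℕ → ℝ) (n : ℕ)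
    (τ h : ℝ) : Prop :=
  0 < h ∧ d (empiricalCDF x n) (kernelCDFEstimator K x n h) = τ

end KernelDiscrepancy

end

/-! The kernel estimator is the empirical distribution function F_n smoothed by K at scale h. Each
admissible distance dominates the uniform one, so a solution h satisfies |F_n - K_h * F_n| ≤ s(n)
everywhere. Replacing F_n by F costs at most (1 + ‖K‖₁) sup |F_n - F|, almost surely O(√(log log n /
n)). The bias F - K_h * F is then of that order, and it remains to see that a small bias forces a
small h (`IsKernelOfOrder.exists_pow_le_bias`).

For small h, mollify F to a smooth Φ. This commutes with smoothing by K_h and does not increase the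
supremum of the bias, and a Taylor expansion leaves, up to sign, h^ℓ Φ^(ℓ)(t₀) / ℓ! times the
nonzero ℓ-th moment. Some t₀ has Φ^(ℓ)(t₀) ≠ 0, since a polynomial cannot tend to 0 at -∞ and to 1
at +∞. For h away from zero, F = K_h * F would make the Fourier transform of K equal to 1 near the
origin, against the ℓ-th moment; compactness in h and the limit h → ∞ make this a uniform lower
bound δ.

The stochastic input is the upper half of the iterated logarithm law for F_n, with an unspecified
constant (`exists_ae_eventually_abs_centredCount_le`): after the probability integral transform, a
maximal Bernstein inequality controls dyadic increments up to time 4^J, and chaining with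
Borel–Cantelli finishes. -/

noncomputable section

namespace KernelDiscrepancy

/-! ### Taylor expansion of kernel averages -/

section MomentExpansion

variable {E : Type*} [NormedAddCommGroup E] [NormedSpace ℝ E]

/-- The remainder of the Taylor expansion at `0` by terms of degree less than `n`. -/
def taylorRemainder (n : ℕ) (g : ℝ → E) (t : ℝ) : E :=
  g t - ∑ k ∈ Finset.range n, (((k.factorial : ℝ))⁻¹ * t ^ k) • iteratedDeriv k g 0

/-- Taylor's theorem in Peano form. The term of degree n is kept in the remainder because the kernel
moments vanish only strictly between the degrees 0 and n. -/
lemma tendsto_taylorRemainder {n : ℕ} {g : ℝ → E} (hg : ContDiff ℝ n g) :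
    Tendsto (fun t : ℝ => (t ^ n)⁻¹ • taylorRemainder n g t) (𝓝[≠] 0)
      (𝓝 ((n.factorial : ℝ)⁻¹ • iteratedDeriv n g 0)) := by
  have h := taylor_tendsto (x₀ := 0) convex_univ (Set.mem_univ 0) hg.contDiffOn
  rw [nhdsWithin_univ] at h
  have h2 := (h.mono_left (nhdsWithin_le_nhds (s := {0}ᶜ))).add_const
    ((n.factorial : ℝ)⁻¹ • iteratedDeriv n g 0)
  rw [zero_add] at h2
  refine h2.congr' ?_
  filter_upwards [self_mem_nhdsWithin] with t ht
  have ht' : t ^ n ≠ 0 := pow_ne_zero _ ht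
  simp only [taylor_within_apply, Finset.sum_range_succ, sub_zero, taylorRemainder,
    iteratedDerivWithin_univ, smul_sub, smul_add, smul_smul]
  rw [mul_comm _ (t ^ n), inv_mul_cancel_left₀ ht']
  abel

/-- Near 0 this is Peano's estimate; away from 0 each power |t|^k with k ≤ n is at most a constant
times |t|^n, so boundedness of g suffices. A global bound is needed to dominate the rescaled
remainder by a multiple of |u|^n |K(u)| for every h ≠ 0. -/
lemma exists_norm_taylorRemainder_le {n : ℕ} (hn : n ≠ 0) {g : ℝ → E} (hg : ContDiff ℝ n g) {M : ℝ}
    (hM : ∀ t, ‖g t‖ ≤ M) : ∃ C, ∀ t, ‖taylorRemainder n g t‖ ≤ C * |t| ^ n := by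
  have h1 := (tendsto_taylorRemainder hg).norm.eventually_lt_const
    (lt_add_one ‖(n.factorial : ℝ)⁻¹ • iteratedDeriv n g 0‖)
  set c := ‖(n.factorial : ℝ)⁻¹ • iteratedDeriv n g 0‖ + 1
  obtain ⟨δ, hδ, h2⟩ := Metric.mem_nhdsWithin_iff.1 h1
  set C := ∑ k ∈ Finset.range n,
    (((k.factorial : ℝ))⁻¹ * (δ ^ (n - k))⁻¹) * ‖iteratedDeriv k g 0‖
  have hM0 : 0 ≤ M := (norm_nonneg _).trans (hM 0)
  have hC0 : 0 ≤ C := by positivity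
  refine ⟨max c (M * (δ ^ n)⁻¹ + C), fun t => ?_⟩
  rcases eq_or_ne t 0 with rfl | ht0
  · have : taylorRemainder n g 0 = 0 := by
      rw [taylorRemainder, Finset.sum_eq_single_of_mem 0 (by simp; omega)]
      · simp
      · intro b _ hb; simp [hb]
    simp [this, hn]
  rcases lt_or_ge |t| δ with ht | ht
  · have h3 : ‖(t ^ n)⁻¹ • taylorRemainder n g t‖ < c :=
      h2 ⟨by simpa using ht, ht0⟩
    rw [norm_smul, norm_inv, norm_pow, Real.norm_eq_abs, inv_mul_lt_iff₀ (by positivity)] at h3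
    calc _ ≤ c * |t| ^ n := by rw [mul_comm]; exact h3.le
      _ ≤ _ := by gcongr; exact le_max_left _ _
  · refine le_trans ?_ (mul_le_mul_of_nonneg_right (le_max_right _ _) (by positivity))
    have hdn : ∀ k ≤ n, 1 ≤ (δ ^ k)⁻¹ * |t| ^ k := fun k _ => by
      rw [inv_mul_eq_div, ← div_pow]
      exact one_le_pow₀ ((one_le_div hδ).2 ht)
    refine (norm_sub_le _ _).trans ?_
    rw [add_mul]
    refine add_le_add ?_ ((norm_sum_le _ _).trans ?_)
    · calc _ ≤ M * 1 := by simpa using hM t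
        _ ≤ M * ((δ ^ n)⁻¹ * |t| ^ n) := by gcongr; exact hdn n le_rfl
        _ = _ := by ring
    · rw [Finset.sum_mul]
      refine Finset.sum_le_sum fun k hk => ?_
      have hk : k < n := Finset.mem_range.1 hk
      rw [norm_smul, norm_mul, norm_inv, norm_pow, Real.norm_eq_abs, Real.norm_eq_abs,
        Nat.abs_cast]
      have h5 : |t| ^ n = |t| ^ (n - k) * |t| ^ k := by rw [← pow_add]; congr 1; omega
      calc _ = ((k.factorial : ℝ)⁻¹ * |t| ^ k) * ‖iteratedDeriv k g 0‖ * 1 := by ring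
        _ ≤ ((k.factorial : ℝ)⁻¹ * |t| ^ k) * ‖iteratedDeriv k g 0‖ *
            ((δ ^ (n - k))⁻¹ * |t| ^ (n - k)) := by gcongr; exact hdn _ (by omega)
        _ = _ := by rw [h5]; ring

lemma IsKernelOfOrder.integrable {K : ℝ → ℝ} {n : ℕ} (hK : IsKernelOfOrder K n) :
    Integrable K := by
  simpa using hK.integrable_moment 0 (Nat.zero_le _)

lemma IsKernelOfOrder.integrable_smul {K : ℝ → ℝ} {n : ℕ} (hK : IsKernelOfOrder K n)
    {g : ℝ → E} (hg : Continuous g) {M : ℝ} (hM : ∀ t, ‖g t‖ ≤ M) :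
    Integrable (fun u => K u • g u) := by
  exact hK.integrable.smul_bdd M hg.aestronglyMeasurable (ae_of_all _ hM)

variable [CompleteSpace E]

/-- The vanishing moments remove every term of the Taylor polynomial except the constant one, which
survives with weight ∫ K = 1. -/
lemma IsKernelOfOrder.integral_smul_taylorRemainder {K : ℝ → ℝ} {n : ℕ} (hn : n ≠ 0)
    (hK : IsKernelOfOrder K n) {g : ℝ → E} (hg : Continuous g) {M : ℝ} (hM : ∀ t, ‖g t‖ ≤ M)
    (h : ℝ) :
    ∫ u, K u • taylorRemainder n g (h * u) = (∫ u, K u • g (h * u)) - g 0 := by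
  have hterm : ∀ k, k < n → Integrable (fun u => K u •
      ((((k.factorial : ℝ))⁻¹ * (h * u) ^ k) • iteratedDeriv k g 0)) := fun k hk => by
    have := ((hK.integrable_moment k hk.le).const_mul ((k.factorial : ℝ)⁻¹ * h ^ k)).smul_const
      (iteratedDeriv k g 0)
    refine this.congr (ae_of_all _ fun u => ?_)
    simp only [smul_smul]; congr 1; ring
  simp only [taylorRemainder, smul_sub, Finset.smul_sum]
  rw [integral_sub (hK.integrable_smul (by fun_prop) fun t => hM _)
    (integrable_finsetSum _ fun k hk => hterm k (Finset.mem_range.1 hk)),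
    integral_finsetSum _ fun k hk => hterm k (Finset.mem_range.1 hk)]
  congr 1
  have hval : ∀ k, ∫ u, K u • ((((k.factorial : ℝ))⁻¹ * (h * u) ^ k) • iteratedDeriv k g 0)
      = (((k.factorial : ℝ))⁻¹ * h ^ k * ∫ u, u ^ k * K u) • iteratedDeriv k g 0 := fun k => by
    rw [← integral_const_mul, ← integral_smul_const]
    congr 1; ext u; rw [smul_smul]; congr 1; ring
  simp only [hval]
  rw [Finset.sum_eq_single_of_mem 0 (by simp; omega)]
  · simp [hK.integral_eq_one]
  · intro k hk hk0
    rw [hK.moment_eq_zero k (Nat.one_le_iff_ne_zero.2 hk0) (Finset.mem_range.1 hk)]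
    simp

/-- The leading term of the bias of a kernel of order `n`. -/
theorem IsKernelOfOrder.tendsto_moment_expansion {K : ℝ → ℝ} {n : ℕ} (hn : n ≠ 0)
    (hK : IsKernelOfOrder K n) {g : ℝ → E} (hg : ContDiff ℝ n g) {M : ℝ} (hM : ∀ t, ‖g t‖ ≤ M) :
    Tendsto (fun h : ℝ => (h ^ n)⁻¹ • ((∫ u, K u • g (h * u)) - g 0)) (𝓝[≠] 0)
      (𝓝 ((∫ u, u ^ n * K u) • (n.factorial : ℝ)⁻¹ • iteratedDeriv n g 0)) := by
  obtain ⟨C, hC⟩ := exists_norm_taylorRemainder_le hn hg hM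
  simp_rw [← hK.integral_smul_taylorRemainder hn hg.continuous hM, ← integral_smul]
  rw [← integral_smul_const]
  have hRc : Continuous (taylorRemainder n g) := by
    have := hg.continuous
    unfold taylorRemainder
    fun_prop
  refine tendsto_integral_filter_of_dominated_convergence (fun u => C * ‖u ^ n * K u‖) ?_ ?_ ?_ ?_
  · filter_upwards with h
    exact ((hK.integrable.aestronglyMeasurable).smul
      (by fun_prop : Continuous fun u => taylorRemainder n g (h * u)).aestronglyMeasurable).const_smul
        _
  · filter_upwards [self_mem_nhdsWithin] with h hh
    refine ae_of_all _ fun u => ?_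
    have hh' : 0 < |h| ^ n := pow_pos (abs_pos.2 hh) _
    rw [norm_smul, norm_smul, norm_mul, norm_inv, norm_pow, norm_pow, inv_mul_le_iff₀ (by simpa using hh')]
    calc _ ≤ ‖K u‖ * (C * |h * u| ^ n) := by gcongr; exact hC _
      _ = _ := by rw [abs_mul, mul_pow]; simp only [Real.norm_eq_abs]; ring
  · exact (hK.integrable_moment n le_rfl).norm.const_mul C
  · refine ae_of_all _ fun u => ?_
    rcases eq_or_ne u 0 with rfl | hu
    · have h0 : taylorRemainder n g 0 = 0 := by
        have := hC 0
        simpa [hn] using this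
      simp [hn, h0]
    · have h1 : Tendsto (fun h : ℝ => h * u) (𝓝[≠] 0) (𝓝[≠] 0) := by
        refine tendsto_nhdsWithin_iff.2 ⟨?_, ?_⟩
        · exact ((continuous_mul_const u).tendsto' 0 0 (by simp)).mono_left nhdsWithin_le_nhds
        · filter_upwards [self_mem_nhdsWithin] with h hh
          exact mul_ne_zero hh hu
      have h2 := ((tendsto_taylorRemainder hg).comp h1).const_smul (u ^ n * K u)
      refine h2.congr' ?_
      filter_upwards [self_mem_nhdsWithin] with h hh
      have : h ^ n ≠ 0 := pow_ne_zero _ hh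
      have : u ^ n ≠ 0 := pow_ne_zero _ hu
      simp only [Function.comp, smul_smul]
      congr 1
      rw [mul_pow]; field_simp

end MomentExpansion

/-! ### Rigidity facts for kernels and polynomials -/

/-- The Fourier transform of a kernel of order `n` is not constant near the origin. -/
lemma IsKernelOfOrder.frequently_fourier_ne_one {K : ℝ → ℝ} {n : ℕ} (hn : n ≠ 0)
    (hK : IsKernelOfOrder K n) :
    ∃ᶠ h in 𝓝[≠] (0 : ℝ), ∫ u, (K u : ℂ) * Complex.exp ((h * u : ℝ) * Complex.I) ≠ 1 := by
  intro hcon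
  have hg : ContDiff ℝ n (fun t : ℝ => Complex.exp (t * Complex.I)) := by
    have : ContDiff ℝ n (fun t : ℝ => (t : ℂ)) := Complex.ofRealCLM.contDiff
    fun_prop
  have h1 := hK.tendsto_moment_expansion hn hg (M := 1)
    (fun t => by rw [Complex.norm_exp_ofReal_mul_I])
  -- Were the transform equal to 1 near 0, the expansion quotient for exp(it) would tend to 0; its
  -- limit is the n-th moment times i^n / n!.
  have h2 : Tendsto (fun h : ℝ => (h ^ n)⁻¹ • ((∫ u, K u • Complex.exp ((h * u : ℝ) * Complex.I))
      - Complex.exp ((0 : ℝ) * Complex.I))) (𝓝[≠] 0) (𝓝 0) := by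
    refine tendsto_const_nhds.congr' ?_
    filter_upwards [hcon] with h hh
    simp only [ne_eq, not_not] at hh
    simp only [Complex.real_smul] at hh ⊢
    rw [hh]; simp
  have h3 := tendsto_nhds_unique h1 h2
  have h4 : iteratedDeriv n (fun t : ℝ => Complex.exp (t * Complex.I)) =
      fun t : ℝ => Complex.I ^ n * Complex.exp (t * Complex.I) := by
    clear h1 h2 h3 hK hg hcon hn
    induction n with
    | zero => simp
    | succ n ih =>
      rw [iteratedDeriv_succ, ih]
      ext t
      have : HasDerivAt (fun t : ℝ => Complex.I ^ n * Complex.exp (t * Complex.I))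
          (Complex.I ^ n * (Complex.exp (t * Complex.I) * (1 * Complex.I))) t :=
        (((Complex.ofRealCLM.hasDerivAt (x := t)).mul_const Complex.I).cexp).const_mul _
      rw [this.deriv]; ring
  rw [h4] at h3
  have := hK.moment_ne_zero
  simp [this, Nat.factorial_ne_zero] at h3

/-- A smooth function with a vanishing iterated derivative that has a limit at infinity is
constant. -/
lemma eq_of_iteratedDeriv_eq_zero {n : ℕ} {g : ℝ → ℝ} (hg : ContDiff ℝ (n + 1) g)
    (h0 : ∀ t, iteratedDeriv (n + 1) g t = 0) {c : ℝ} (hc : Tendsto g atTop (𝓝 c)) (x : ℝ) :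
    g x = c := by
  -- The derivative of the Taylor polynomial in its base point involves only the derivative of order
  -- n + 1, so the base point can be moved from 0 to x. Hence g is a polynomial.
  have hT : ∀ x, taylorWithinEval g n Set.univ 0 x = g x := by
    intro x
    have hd : ∀ y, HasDerivAt (fun t => taylorWithinEval g n Set.univ t x) 0 y := fun y => by
      have := hasDerivWithinAt_taylorWithinEval (n := n) (x := x) (y := y) uniqueDiffOn_univ
        (s' := Set.univ) univ_mem (Set.mem_univ _) (Set.subset_univ _)
        (hg.of_le (by norm_cast; exact Nat.le_succ n)).contDiffOn
        (by
          rw [iteratedDerivWithin_univ]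
          exact ((hg.differentiable_iteratedDeriv n (by norm_cast; omega)) y).differentiableWithinAt)
      rw [iteratedDerivWithin_univ, h0, smul_zero, hasDerivWithinAt_univ] at this
      exact this
    have := is_const_of_deriv_eq_zero (fun y => (hd y).differentiableAt) (fun y => (hd y).deriv) 0 x
    rw [this, taylorWithinEval_self]
  set p : Polynomial ℝ := ∑ k ∈ Finset.range (n + 1),
    Polynomial.C ((k.factorial : ℝ)⁻¹ * iteratedDeriv k g 0) * Polynomial.X ^ k
  have hp : ∀ x, g x = p.eval x := fun x => by
    rw [← hT, taylor_within_apply, Polynomial.eval_finsetSum]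
    refine Finset.sum_congr rfl fun k _ => ?_
    simp only [sub_zero, iteratedDerivWithin_univ, smul_eq_mul, Polynomial.eval_mul,
      Polynomial.eval_C, Polynomial.eval_pow, Polynomial.eval_X]
    ring
  have hlim : Tendsto (fun x => p.eval x) atTop (𝓝 c) := by simpa only [← hp] using hc
  obtain ⟨h1, h2⟩ := p.tendsto_nhds_iff.1 hlim
  rw [hp, ← h1, Polynomial.leadingCoeff, Polynomial.natDegree_eq_zero_iff_degree_le_zero.2 h2]
  conv_lhs => rw [Polynomial.eq_C_of_degree_le_zero h2, Polynomial.eval_C]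

/-! ### Lower bounds for the smoothing bias -/

/-- `F` is the distribution function of a probability measure without atoms. -/
structure IsContinuousCDF (F : ℝ → ℝ) : Prop where
  monotone : Monotone F
  continuous : Continuous F
  tendsto_atBot : Tendsto F atBot (𝓝 0)
  tendsto_atTop : Tendsto F atTop (𝓝 1)

namespace IsContinuousCDF

variable {F : ℝ → ℝ} (hF : IsContinuousCDF F)
include hF

lemma nonneg (t : ℝ) : 0 ≤ F t := hF.monotone.le_of_tendsto hF.tendsto_atBot t

lemma le_one (t : ℝ) : F t ≤ 1 := hF.monotone.ge_of_tendsto hF.tendsto_atTop t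

lemma norm_le_one (t : ℝ) : ‖F t‖ ≤ 1 := by
  rw [Real.norm_eq_abs, abs_of_nonneg (hF.nonneg t)]; exact hF.le_one t

lemma exists_ne (c : ℝ) : ∃ t, F t ≠ c := by
  by_contra! h
  have h1 := tendsto_nhds_unique hF.tendsto_atTop (by simp only [funext h]; exact tendsto_const_nhds)
  have h0 := tendsto_nhds_unique hF.tendsto_atBot (by simp only [funext h]; exact tendsto_const_nhds)
  linarith

end IsContinuousCDF

/-- The difference between `F` and its smoothing by the kernel `K` with bandwidth `h`. -/
def smoothingBias (K F : ℝ → ℝ) (h t : ℝ) : ℝ := F t - ∫ u, K u * F (t - h * u)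

section Bias

variable {K F : ℝ → ℝ} {n : ℕ}

lemma tendsto_integral_convolution_kernel {ψ : ℝ → ℝ} (hψ : Integrable ψ) (hF : IsContinuousCDF F)
    {l : Filter ℝ} [l.IsCountablyGenerated] {c : ℝ}
    (hl : ∀ y, Tendsto (fun t => F (t - y)) l (𝓝 c)) :
    Tendsto (fun t => ∫ y, ψ y * F (t - y)) l (𝓝 ((∫ y, ψ y) * c)) := by
  rw [← integral_mul_const]
  refine tendsto_integral_filter_of_dominated_convergence (fun y => ‖ψ y‖) ?_ ?_ hψ.norm ?_
  · have := hF.continuous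
    exact Eventually.of_forall fun t => hψ.aestronglyMeasurable.mul
      (by fun_prop : Continuous fun y => F (t - y)).aestronglyMeasurable
  · refine Eventually.of_forall fun t => ae_of_all _ fun y => ?_
    rw [norm_mul]
    exact mul_le_of_le_one_right (norm_nonneg _) (hF.norm_le_one _)
  · exact ae_of_all _ fun y => (hl y).const_mul _

/-- For small bandwidths the bias is at least of order `h ^ n`. -/
lemma IsKernelOfOrder.exists_bias_ge_of_small (hn : n ≠ 0) (hK : IsKernelOfOrder K n)
    (hF : IsContinuousCDF F) :
    ∃ c > 0, ∃ h₀ > 0, ∀ h, 0 < h → h < h₀ → ∀ D, (∀ t, |smoothingBias K F h t| ≤ D) →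
      c * h ^ n ≤ D := by
  -- F is only continuous, so it is mollified before expanding. As ψ is a probability density, a
  -- ψ-average of the bias is still at most D.
  let b : ContDiffBump (0 : ℝ) := ⟨1, 2, one_pos, one_lt_two⟩
  set ψ : ℝ → ℝ := b.normed volume
  have hψ0 : ∀ y, 0 ≤ ψ y := b.nonneg_normed
  have hψi : Integrable ψ := b.integrable_normed
  have hψ1 : ∫ y, ψ y = 1 := b.integral_normed
  have hFc := hF.continuous
  set Φ : ℝ → ℝ := fun t => ∫ y, ψ y * F (t - y) with hΦ
  have hΦs : ContDiff ℝ ((⊤ : ℕ∞) : WithTop ℕ∞) Φ := by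
    have := b.hasCompactSupport_normed.contDiff_convolution_left (μ := volume)
      (ContinuousLinearMap.lsmul ℝ ℝ) (n := ⊤)
      (b.contDiff_normed (μ := volume)) (hFc.locallyIntegrable (μ := volume))
    exact this
  have hmulint : ∀ t, Integrable fun y => ψ y * F (t - y) := fun t =>
    hψi.mul_bdd (c := 1) (by fun_prop : Continuous fun y => F (t - y)).aestronglyMeasurable
      (ae_of_all _ fun y => hF.norm_le_one _)
  have hΦb : ∀ t, ‖Φ t‖ ≤ 1 := fun t => by
    refine (norm_integral_le_of_norm_le hψi (ae_of_all _ fun y => ?_)).trans hψ1.le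
    rw [norm_mul, Real.norm_of_nonneg (hψ0 y)]
    exact mul_le_of_le_one_right (hψ0 y) (hF.norm_le_one _)
  have hΦtop : Tendsto Φ atTop (𝓝 1) := by
    simpa [hψ1] using tendsto_integral_convolution_kernel hψi hF
      fun y => hF.tendsto_atTop.comp (tendsto_atTop_add_const_right _ (-y) tendsto_id)
  have hΦbot : Tendsto Φ atBot (𝓝 0) := by
    simpa [hψ1] using tendsto_integral_convolution_kernel hψi hF
      fun y => hF.tendsto_atBot.comp (tendsto_atBot_add_const_right _ (-y) tendsto_id)
  -- Otherwise Φ would be constantly 1, its limit at +∞, against its limit 0 at -∞.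
  obtain ⟨t₀, ht₀⟩ : ∃ t₀, iteratedDeriv n Φ t₀ ≠ 0 := by
    by_contra! hcon
    obtain ⟨m, rfl⟩ := Nat.exists_eq_succ_of_ne_zero hn
    have := eq_of_iteratedDeriv_eq_zero (hΦs.of_le (by exact_mod_cast le_top)) hcon hΦtop
    have h0 := tendsto_nhds_unique hΦbot
      (by simp only [funext this]; exact tendsto_const_nhds)
    norm_num at h0
  have hg : ContDiff ℝ n (fun s => Φ (t₀ - s)) := by
    have : ContDiff ℝ n Φ := hΦs.of_le (by exact_mod_cast le_top)
    fun_prop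
  have hlim := hK.tendsto_moment_expansion hn hg (M := 1) fun t => hΦb _
  rw [iteratedDeriv_comp_const_sub] at hlim
  set a := (∫ u, u ^ n * K u) • (n.factorial : ℝ)⁻¹ • (-1 : ℝ) ^ n • iteratedDeriv n Φ (t₀ - 0)
    with ha
  have ha0 : a ≠ 0 := by
    simp [ha, hK.moment_ne_zero, Nat.factorial_ne_zero, ht₀]
  clear_value a
  have hev := hlim.norm.eventually_const_lt (half_lt_self (norm_pos_iff.2 ha0))
  obtain ⟨h₀, hh₀, hev⟩ := Metric.mem_nhdsWithin_iff.1 hev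
  refine ⟨‖a‖ / 2, half_pos (norm_pos_iff.2 ha0), h₀, hh₀, fun h h0 hh D hD => ?_⟩
  have h1 : ‖a‖ / 2 < ‖(h ^ n)⁻¹ • ((∫ u, K u • Φ (t₀ - h * u)) - Φ (t₀ - 0))‖ :=
    hev ⟨by simpa [abs_of_pos h0] using hh, h0.ne'⟩
  rw [norm_smul, norm_inv, norm_pow, Real.norm_of_nonneg h0.le, lt_inv_mul_iff₀ (by positivity)]
    at h1
  rw [mul_comm]
  refine h1.le.trans ?_
  have hprod : Integrable (Function.uncurry fun u y => K u * (ψ y * F (t₀ - h * u - y)))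
      (volume.prod volume) := by
    have h2 := (hK.integrable.mul_prod hψi).mul_bdd (c := 1)
      (g := fun z : ℝ × ℝ => F (t₀ - h * z.1 - z.2))
      (by fun_prop : Continuous fun z : ℝ × ℝ => F (t₀ - h * z.1 - z.2)).aestronglyMeasurable
      (ae_of_all _ fun z => hF.norm_le_one _)
    refine h2.congr (ae_of_all _ fun z => ?_)
    simp only [Function.uncurry]; ring
  have hswap : ∫ u, K u • Φ (t₀ - h * u) = ∫ y, ψ y * ∫ u, K u * F (t₀ - y - h * u) := by
    calc _ = ∫ u, ∫ y, K u * (ψ y * F (t₀ - h * u - y)) := by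
          simp only [hΦ, smul_eq_mul, integral_const_mul]
      _ = ∫ y, ∫ u, K u * (ψ y * F (t₀ - h * u - y)) := integral_integral_swap hprod
      _ = _ := by
        congr 1; ext y; rw [← integral_const_mul]; congr 1; ext u
        rw [sub_right_comm]; ring
  have hKint : Integrable fun y => ψ y * ∫ u, K u * F (t₀ - y - h * u) := by
    refine hprod.integral_prod_right.congr (ae_of_all _ fun y => ?_)
    simp only [Function.uncurry]
    rw [← integral_const_mul]; congr 1; ext u
    rw [sub_right_comm]; ring
  -- By Fubini the bias of Φ at t₀ is, up to sign, a ψ-average of the bias of F.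
  have heq : (∫ u, K u • Φ (t₀ - h * u)) - Φ (t₀ - 0) =
      ∫ y, -(ψ y * smoothingBias K F h (t₀ - y)) := by
    rw [hswap, sub_zero, ← integral_sub hKint (hmulint t₀)]
    congr 1; ext y; simp only [smoothingBias]; ring
  rw [heq]
  have := norm_integral_le_of_norm_le (f := fun y => -(ψ y * smoothingBias K F h (t₀ - y)))
    (hψi.mul_const D) (ae_of_all _ fun y => by
      rw [norm_neg, norm_mul, Real.norm_of_nonneg (hψ0 y)]
      exact mul_le_mul_of_nonneg_left (hD _) (hψ0 y))
  rwa [integral_mul_const, hψ1, one_mul] at this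

lemma continuous_smoothingBias (hK : Integrable K) (hF : IsContinuousCDF F) (t : ℝ) :
    Continuous fun h => smoothingBias K F h t := by
  have hFc := hF.continuous
  refine continuous_const.sub (continuous_of_dominated (bound := fun u => ‖K u‖) ?_ ?_ hK.norm ?_)
  · exact fun h => hK.aestronglyMeasurable.mul
      (by fun_prop : Continuous fun u => F (t - h * u)).aestronglyMeasurable
  · refine fun h => ae_of_all _ fun u => ?_
    rw [norm_mul]
    exact mul_le_of_le_one_right (norm_nonneg _) (hF.norm_le_one _)
  · exact ae_of_all _ fun u => by fun_prop

/-- As h → ∞ the argument t - hu tends to +∞ for u < 0 and to -∞ for u > 0, so K_h * F flattens to a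
constant. Since F is not constant, some t retains a nonzero limiting bias. -/
lemma tendsto_smoothingBias_atTop (hK : Integrable K) (hF : IsContinuousCDF F) (t : ℝ) :
    Tendsto (fun h => smoothingBias K F h t) atTop (𝓝 (F t - ∫ u in Set.Iio 0, K u)) := by
  have hFc := hF.continuous
  refine tendsto_const_nhds.sub ?_
  rw [← integral_indicator measurableSet_Iio]
  refine tendsto_integral_filter_of_dominated_convergence (fun u => ‖K u‖) ?_ ?_ hK.norm ?_
  · exact Eventually.of_forall fun h => hK.aestronglyMeasurable.mul
      (by fun_prop : Continuous fun u => F (t - h * u)).aestronglyMeasurable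
  · refine Eventually.of_forall fun h => ae_of_all _ fun u => ?_
    rw [norm_mul]
    exact mul_le_of_le_one_right (norm_nonneg _) (hF.norm_le_one _)
  · filter_upwards [compl_mem_ae_iff.2 (measure_singleton (0 : ℝ))] with u hu
    have hu : u ≠ 0 := hu
    rcases hu.lt_or_gt with hu | hu
    · have h1 : Tendsto (fun h : ℝ => t - h * u) atTop atTop := by
        have := tendsto_atTop_add_const_left atTop t
          (tendsto_id.atTop_mul_const (neg_pos.2 hu))
        simpa [sub_eq_add_neg] using this
      simpa [Set.indicator_of_mem (Set.mem_Iio.2 hu)] using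
        (hF.tendsto_atTop.comp h1).const_mul (K u)
    · have h1 : Tendsto (fun h : ℝ => t - h * u) atTop atBot := by
        have := tendsto_atBot_add_const_left atTop t
          (tendsto_neg_atTop_atBot.comp (tendsto_id.atTop_mul_const hu))
        simpa [sub_eq_add_neg] using this
      have h2 : u ∉ Set.Iio (0 : ℝ) := not_lt.2 hu.le
      simpa [Set.indicator_of_notMem h2] using (hF.tendsto_atBot.comp h1).const_mul (K u)

/-- The increments `F (t + 1) - F t` of a distribution function form a probability density. -/
lemma IsContinuousCDF.integrable_increment (hF : IsContinuousCDF F) :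
    Integrable (fun t => F (t + 1) - F t) ∧ ∫ t, (F (t + 1) - F t) = 1 := by
  have hFc := hF.continuous
  have hi : ∀ a b, IntervalIntegrable F volume a b := fun a b => hFc.intervalIntegrable a b
  -- The integral telescopes to a difference of two averages of F over unit windows, with limits 1
  -- and 0.
  have hval : ∀ A : ℝ, ∫ t in (-A)..A, (F (t + 1) - F t) =
      (∫ t in A..(A + 1), F t) - ∫ t in (-A)..(-A + 1), F t := by
    intro A
    rw [intervalIntegral.integral_sub (Continuous.intervalIntegrable (by fun_prop) _ _) (hi _ _),
      intervalIntegral.integral_comp_add_right (fun t => F t)]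
    have h1 := intervalIntegral.integral_add_adjacent_intervals (hi (-A) (-A + 1)) (hi (-A + 1) (A + 1))
    have h2 := intervalIntegral.integral_add_adjacent_intervals (hi (-A) A) (hi A (A + 1))
    linarith
  have hnn : ∀ t, 0 ≤ F (t + 1) - F t := fun t => sub_nonneg.2 (hF.monotone (by linarith))
  have hle : ∀ A, F A ≤ ∫ t in A..(A + 1), F t := fun A => by
    have := intervalIntegral.integral_mono_on (a := A) (b := A + 1) (by linarith)
      (_root_.intervalIntegrable_const (c := F A)) (hi _ _) fun x hx => hF.monotone hx.1
    simpa using this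
  have hge : ∀ A, ∫ t in A..(A + 1), F t ≤ F (A + 1) := fun A => by
    have := intervalIntegral.integral_mono_on (a := A) (b := A + 1) (by linarith)
      (hi _ _) (_root_.intervalIntegrable_const (c := F (A + 1))) fun x hx => hF.monotone hx.2
    simpa using this
  have hint : Integrable (fun t => F (t + 1) - F t) := by
    refine integrable_of_intervalIntegral_norm_bounded (l := (atTop : Filter ℝ)) 1
      (a := fun A => -A) (b := fun A => A)
      (fun A => (Continuous.integrableOn_Ioc (by fun_prop))) tendsto_neg_atTop_atBot tendsto_id
      (Eventually.of_forall fun A => ?_)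
    simp only [Real.norm_of_nonneg (hnn _)]
    rw [hval]
    linarith [hge A, hle (-A), hF.nonneg (-A), hF.le_one (A + 1)]
  refine ⟨hint, ?_⟩
  have h1 := intervalIntegral_tendsto_integral (l := (atTop : Filter ℝ)) hint
    tendsto_neg_atTop_atBot tendsto_id
  refine tendsto_nhds_unique h1 ?_
  simp only [hval, id]
  have hup : Tendsto (fun A : ℝ => ∫ t in A..(A + 1), F t) atTop (𝓝 1) :=
    tendsto_of_tendsto_of_tendsto_of_le_of_le hF.tendsto_atTop
      (hF.tendsto_atTop.comp (tendsto_atTop_add_const_right _ 1 tendsto_id)) hle hge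
  have hdn : Tendsto (fun A : ℝ => ∫ t in A..(A + 1), F t) atBot (𝓝 0) :=
    tendsto_of_tendsto_of_tendsto_of_le_of_le hF.tendsto_atBot
      (hF.tendsto_atBot.comp (tendsto_atBot_add_const_right _ 1 tendsto_id)) hle hge
  simpa using hup.sub (hdn.comp tendsto_neg_atTop_atBot)

/-- A continuous distribution function is never reproduced by smoothing. -/
lemma IsKernelOfOrder.exists_smoothingBias_ne_zero (hn : n ≠ 0) (hK : IsKernelOfOrder K n)
    (hF : IsContinuousCDF F) {h : ℝ} (hh : h ≠ 0) : ∃ t, smoothingBias K F h t ≠ 0 := by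
  by_contra! hcon
  have hFc := hF.continuous
  obtain ⟨hpi, hp1⟩ := hF.integrable_increment
  -- F itself is not integrable; its unit increments are, and they inherit the identity p = K_h * p.
  set p : ℝ → ℝ := fun t => F (t + 1) - F t with hp
  have hpc : Continuous p := by fun_prop
  have hKF : ∀ t, Integrable fun u => K u * F (t - h * u) := fun t =>
    hK.integrable_smul (g := fun u => F (t - h * u)) (by fun_prop) fun u => hF.norm_le_one _
  have hconv : ∀ t, p t = ∫ u, K u * p (t - h * u) := by
    intro t
    have h1 := hcon (t + 1)
    have h2 := hcon t
    simp only [smoothingBias, sub_eq_zero] at h1 h2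
    simp only [hp]
    conv_lhs => rw [h1, h2]
    rw [← integral_sub (hKF _) (hKF _)]
    congr 1; ext u; rw [show t + 1 - h * u = t - h * u + 1 by ring]; ring
  set e : ℝ → ℂ := fun t => Complex.exp ((t : ℝ) * Complex.I) with he
  have hec : Continuous e := by fun_prop
  have hen : ∀ t, ‖e t‖ = 1 := fun t => Complex.norm_exp_ofReal_mul_I t
  have headd : ∀ s t, e (s + t) = e s * e t := fun s t => by
    simp only [he, ← Complex.exp_add]; congr 1; push_cast; ring
  set q : ℝ → ℂ := fun ξ => ∫ t, (p t : ℂ) * e (ξ * t) with hq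
  have hqc : Continuous q := by
    refine continuous_of_dominated (bound := fun t => ‖p t‖) (fun ξ => ?_) (fun ξ => ?_) hpi.norm ?_
    · exact Continuous.aestronglyMeasurable (by fun_prop)
    · exact ae_of_all _ fun t => by rw [norm_mul, hen, mul_one, Complex.norm_real]
    · exact ae_of_all _ fun t => by fun_prop
  have hq0 : q 0 = 1 := by
    simp only [hq, he]
    simp only [zero_mul, Complex.ofReal_zero, Complex.exp_zero, mul_one]
    rw [integral_complex_ofReal, hp1, Complex.ofReal_one]
  -- On the Fourier side the convolution identity is multiplicative. Since q is continuous with q(0)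
  -- = 1, it can be cancelled near 0, leaving 1 for the transform of K.
  have hmul : ∀ ξ, q ξ = (∫ u, (K u : ℂ) * e (ξ * h * u)) * q ξ := by
    intro ξ
    have hprod : Integrable (Function.uncurry fun u t => (K u : ℂ) * (p (t - h * u) * e (ξ * t)))
        (volume.prod volume) := by
      have hms : AEStronglyMeasurable
          (Function.uncurry fun u t => (K u : ℂ) * (p (t - h * u) * e (ξ * t)))
          (volume.prod volume) := by
        refine AEStronglyMeasurable.mul ?_ (Continuous.aestronglyMeasurable (by fun_prop))
        exact (Complex.continuous_ofReal.comp_aestronglyMeasurable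
          hK.integrable.aestronglyMeasurable).comp_fst
      refine (integrable_prod_iff hms).2 ⟨ae_of_all _ fun u => ?_, ?_⟩
      · have hpu : Integrable fun t => ((p (t - h * u) : ℝ) : ℂ) :=
          (hpi.comp_sub_right (h * u)).ofReal
        have hpe : Integrable fun t => ((p (t - h * u) : ℝ) : ℂ) * e (ξ * t) :=
          hpu.mul_bdd (c := 1) (Continuous.aestronglyMeasurable (by fun_prop))
            (ae_of_all _ fun t => (hen _).le)
        exact hpe.const_mul (K u : ℂ)
      · simp only [Function.uncurry, norm_mul, hen, mul_one, integral_const_mul, Complex.norm_real]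
        have : ∀ u, ∫ t, ‖p (t - h * u)‖ = ∫ t, ‖p t‖ := fun u =>
          integral_sub_right_eq_self (fun t => ‖p t‖) (h * u)
        simp only [this]
        exact hK.integrable.norm.mul_const _
    calc q ξ = ∫ t, ∫ u, (K u : ℂ) * (p (t - h * u) * e (ξ * t)) := by
          simp only [hq]
          congr 1; ext t
          rw [hconv t, ← integral_complex_ofReal, ← integral_mul_const]
          congr 1; ext u; push_cast; ring
      _ = ∫ u, ∫ t, (K u : ℂ) * (p (t - h * u) * e (ξ * t)) :=
          (integral_integral_swap hprod).symm
      _ = ∫ u, ((K u : ℂ) * e (ξ * h * u)) * q ξ := by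
          congr 1; ext u
          rw [integral_const_mul, mul_assoc]
          congr 1
          rw [← integral_const_mul,
            ← integral_sub_right_eq_self (fun t => e (ξ * h * u) * ((p t : ℂ) * e (ξ * t))) (h * u)]
          congr 1; ext t
          rw [show ξ * t = ξ * h * u + ξ * (t - h * u) by ring, headd]; ring
      _ = _ := integral_mul_const _ _
  have hdiv : Tendsto (fun s : ℝ => s / h) (𝓝[≠] 0) (𝓝 0) :=
    ((continuous_id.div_const h).tendsto' 0 0 (by simp)).mono_left nhdsWithin_le_nhds
  have hqev : ∀ᶠ s in 𝓝[≠] (0 : ℝ), q (s / h) ≠ 0 := by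
    refine hdiv.eventually (hqc.continuousAt.eventually_ne ?_)
    rw [hq0]; exact one_ne_zero
  obtain ⟨s, hs1, hs2⟩ := ((hK.frequently_fourier_ne_one hn).and_eventually hqev).exists
  refine hs1 ?_
  have := hmul (s / h)
  rw [div_mul_cancel₀ s hh] at this
  exact (mul_right_cancel₀ hs2 (this.symm.trans (one_mul _).symm))

/-- Away from zero bandwidths the bias is bounded below. -/
lemma IsKernelOfOrder.exists_bias_ge_of_large (hn : n ≠ 0) (hK : IsKernelOfOrder K n)
    (hF : IsContinuousCDF F) {h₀ : ℝ} (hh₀ : 0 < h₀) :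
    ∃ δ > 0, ∀ h ≥ h₀, ∀ D, (∀ t, |smoothingBias K F h t| ≤ D) → δ ≤ D := by
  -- A uniform positive lower bound survives finite unions, so it passes from neighbourhoods to a
  -- compact interval of bandwidths and then joins the tail near +∞.
  let Q : Set ℝ → Prop := fun S => ∃ δ > 0, ∀ h ∈ S, ∀ D, (∀ t, |smoothingBias K F h t| ≤ D) → δ ≤ D
  have hQu : ∀ ⦃S T⦄, Q S → Q T → Q (S ∪ T) := by
    rintro S T ⟨δ, hδ, h1⟩ ⟨δ', hδ', h2⟩
    refine ⟨min δ δ', lt_min hδ hδ', ?_⟩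
    rintro h (hS | hT) D hD
    · exact (min_le_left _ _).trans (h1 h hS D hD)
    · exact (min_le_right _ _).trans (h2 h hT D hD)
  have htend : ∀ {l : Filter ℝ} {t a : ℝ}, a ≠ 0 → Tendsto (fun h => smoothingBias K F h t) l (𝓝 a) →
      ∃ S ∈ l, Q S := by
    intro l t a ha hl
    refine ⟨_, hl.norm.eventually_const_lt (half_lt_self (norm_pos_iff.2 ha)), ‖a‖ / 2,
      half_pos (norm_pos_iff.2 ha), fun h hh D hD => ?_⟩
    exact (le_of_lt hh).trans (hD t)
  obtain ⟨t, ht⟩ := hF.exists_ne (∫ u in Set.Iio 0, K u)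
  obtain ⟨S, hS, hQS⟩ := htend (sub_ne_zero.2 ht) (tendsto_smoothingBias_atTop hK.integrable hF t)
  obtain ⟨H, hH⟩ := mem_atTop_sets.1 hS
  have hcomp : Q (Set.Icc h₀ H) := by
    refine isCompact_Icc.induction_on ⟨1, one_pos, fun _ h => h.elim⟩ ?_ hQu ?_
    · rintro S T hST ⟨δ, hδ, h1⟩
      exact ⟨δ, hδ, fun h hh => h1 h (hST hh)⟩
    · intro h hh
      obtain ⟨t, ht⟩ := hK.exists_smoothingBias_ne_zero hn hF (hh₀.trans_le hh.1).ne'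
      exact htend ht ((continuous_smoothingBias hK.integrable hF t).continuousWithinAt)
  obtain ⟨δ, hδ, h1⟩ := hQu hcomp hQS
  refine ⟨δ, hδ, fun h hh => h1 h ?_⟩
  rcases le_total h H with hle | hle
  · exact Or.inl ⟨hh, hle⟩
  · exact Or.inr (hH h hle)

/-- A small bias forces a small bandwidth. -/
theorem IsKernelOfOrder.exists_pow_le_bias (hn : n ≠ 0) (hK : IsKernelOfOrder K n)
    (hF : IsContinuousCDF F) :
    ∃ c > 0, ∃ δ > 0, ∀ h > 0, ∀ D, (∀ t, |smoothingBias K F h t| ≤ D) → D < δ → c * h ^ n ≤ D := by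
  obtain ⟨c, hc, h₀, hh₀, h1⟩ := hK.exists_bias_ge_of_small hn hF
  obtain ⟨δ, hδ, h2⟩ := hK.exists_bias_ge_of_large hn hF hh₀
  refine ⟨c, hc, δ, hδ, fun h hh D hD hDδ => ?_⟩
  rcases lt_or_ge h h₀ with hlt | hge
  · exact h1 h hh hlt D hD
  · exact absurd (h2 h hge D hD) (not_le.2 hDδ)

end Bias

/-! ### A maximal exponential inequality -/

section MaximalInequality

variable {Ω : Type*} [MeasurableSpace Ω] {P : Measure Ω} [IsProbabilityMeasure P]

lemma integrable_exp_mul_of_bounded {Z : Ω → ℝ} (hZ : Measurable Z) {B : ℝ} (hB : ∀ ω, |Z ω| ≤ B)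
    (c : ℝ) : Integrable (fun ω => Real.exp (c * Z ω)) P := by
  refine Integrable.of_bound (C := Real.exp (|c| * B)) (by fun_prop) (ae_of_all _ fun ω => ?_)
  rw [Real.norm_eq_abs, Real.abs_exp, Real.exp_le_exp]
  exact (le_abs_self _).trans (by rw [abs_mul]; gcongr; exact hB ω)

lemma integrable_of_abs_le {Z : Ω → ℝ} (hZ : Measurable Z) {B : ℝ} (hB : ∀ ω, |Z ω| ≤ B) :
    Integrable Z P :=
  Integrable.of_bound hZ.aestronglyMeasurable B (ae_of_all _ hB)

/-- From exp(x) ≤ 1 + x + x² for |x| ≤ 1, where the linear term has mean zero. The exponent sees the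
variance, not the range, which is what makes short intervals contribute little. -/
lemma mgf_le_of_abs_le_one {Y : Ω → ℝ} (hY : Measurable Y) (hY1 : ∀ ω, |Y ω| ≤ 1)
    (hY0 : ∫ ω, Y ω ∂P = 0) {v : ℝ} (hv : ∫ ω, Y ω ^ 2 ∂P ≤ v) {c : ℝ} (hc : |c| ≤ 1) :
    mgf Y P c ≤ Real.exp (c ^ 2 * v) := by
  have hi1 : Integrable Y P := integrable_of_abs_le hY hY1
  have hi2 : Integrable (fun ω => Y ω ^ 2) P :=
    integrable_of_abs_le (by fun_prop) (B := 1) fun ω => by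
      rw [abs_pow]; exact pow_le_one₀ (abs_nonneg _) (hY1 ω)
  have hle : ∀ ω, Real.exp (c * Y ω) ≤ 1 + c * Y ω + c ^ 2 * Y ω ^ 2 := fun ω => by
    have h1 : |c * Y ω| ≤ 1 := by
      rw [abs_mul]; exact mul_le_one₀ hc (abs_nonneg _) (hY1 ω)
    have := (abs_le.1 (Real.abs_exp_sub_one_sub_id_le h1)).2
    rw [mul_pow] at this
    linarith
  have hi : Integrable (fun ω => 1 + c * Y ω + c ^ 2 * Y ω ^ 2) P :=
    ((integrable_const _).add (hi1.const_mul _)).add (hi2.const_mul _)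
  calc mgf Y P c ≤ ∫ ω, (1 + c * Y ω + c ^ 2 * Y ω ^ 2) ∂P :=
        integral_mono (integrable_exp_mul_of_bounded hY hY1 c) hi hle
    _ = 1 + c ^ 2 * ∫ ω, Y ω ^ 2 ∂P := by
        have hi0 : Integrable (fun ω => 1 + c * Y ω) P :=
          (integrable_const _).add (hi1.const_mul _)
        rw [integral_add hi0 (hi2.const_mul _),
          integral_add (integrable_const _) (hi1.const_mul _), integral_const_mul,
          integral_const_mul, hY0]
        simp
    _ ≤ 1 + c ^ 2 * v := by gcongr
    _ ≤ _ := by linarith [Real.add_one_le_exp (c ^ 2 * v)]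

lemma abs_sum_range_le {α : Type*} {Y : ℕ → α → ℝ} (hY1 : ∀ i ω, |Y i ω| ≤ 1) (n : ℕ) (ω : α) :
    |∑ i ∈ Finset.range n, Y i ω| ≤ n := by
  refine (Finset.abs_sum_le_sum_abs _ _).trans ?_
  simpa using Finset.sum_le_sum fun i (_ : i ∈ Finset.range n) => hY1 i ω

/-- By independence, one step multiplies the conditional mean by E exp(cY) ≥ 1 + c E Y = 1. The sum
has n + 1 terms because the natural filtration at time n already contains Y n. -/
lemma submartingale_exp_sum {Y : ℕ → Ω → ℝ} (hY : ∀ i, Measurable (Y i)) (hind : iIndepFun Y P)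
    (hY1 : ∀ i ω, |Y i ω| ≤ 1) (hY0 : ∀ i, ∫ ω, Y i ω ∂P = 0) (c : ℝ) :
    Submartingale (fun n ω => Real.exp (c * ∑ i ∈ Finset.range (n + 1), Y i ω))
      (Filtration.natural Y fun i => (hY i).stronglyMeasurable) P := by
  set 𝒢 := Filtration.natural Y fun i => (hY i).stronglyMeasurable
  have hint : ∀ n, Integrable (fun ω => Real.exp (c * ∑ i ∈ Finset.range n, Y i ω)) P := fun n =>
    integrable_exp_mul_of_bounded (Finset.measurable_sum _ fun i _ => hY i)
      (abs_sum_range_le hY1 n) c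
  have hadp : StronglyAdapted 𝒢 fun n ω => Real.exp (c * ∑ i ∈ Finset.range (n + 1), Y i ω) := by
    intro n
    have h1 : Measurable[𝒢 n] fun ω => ∑ i ∈ Finset.range (n + 1), Y i ω :=
      Finset.measurable_sum _ fun i hi =>
        (((Filtration.stronglyAdapted_natural fun i => (hY i).stronglyMeasurable) i).mono
          (𝒢.mono (Nat.lt_succ_iff.1 (Finset.mem_range.1 hi)))).measurable
    exact (Real.measurable_exp.comp (h1.const_mul c)).stronglyMeasurable
  refine submartingale_nat hadp (fun n => hint _) fun n => ?_
  have hE : Integrable (fun ω => Real.exp (c * Y (n + 1) ω)) P :=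
    integrable_exp_mul_of_bounded (hY _) (hY1 _) c
  have heq : (fun ω => Real.exp (c * ∑ i ∈ Finset.range (n + 1 + 1), Y i ω)) =
      (fun ω => Real.exp (c * ∑ i ∈ Finset.range (n + 1), Y i ω)) *
        fun ω => Real.exp (c * Y (n + 1) ω) := by
    ext ω
    rw [Pi.mul_apply, ← Real.exp_add, Finset.sum_range_succ, mul_add]
  have hpull := condExp_mul_of_stronglyMeasurable_left (hadp n) (heq ▸ hint _) hE
  have hcond : P[fun ω => Real.exp (c * Y (n + 1) ω) | 𝒢 n] =ᵐ[P]
      fun _ => ∫ ω, Real.exp (c * Y (n + 1) ω) ∂P := by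
    refine condExp_indep_eq (hY (n + 1)).comap_le (𝒢.le n) ?_
      (hind.indep_comap_natural_of_lt (fun i => (hY i).stronglyMeasurable) (Nat.lt_succ_self n))
    exact (Real.measurable_exp.comp
      ((comap_measurable (Y (n + 1))).const_mul c)).stronglyMeasurable
  have hge : 1 ≤ ∫ ω, Real.exp (c * Y (n + 1) ω) ∂P := by
    have hi1 : Integrable (Y (n + 1)) P := integrable_of_abs_le (hY _) (hY1 _)
    calc (1 : ℝ) = ∫ ω, (c * Y (n + 1) ω + 1) ∂P := by
          rw [integral_add (hi1.const_mul _) (integrable_const _), integral_const_mul, hY0]; simp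
      _ ≤ _ := integral_mono ((hi1.const_mul _).add (integrable_const _)) hE
          fun ω => Real.add_one_le_exp _
  rw [heq]
  filter_upwards [hpull, hcond] with ω h1 h2
  rw [h1, Pi.mul_apply, h2]
  exact le_mul_of_one_le_right (Real.exp_pos _).le hge

/-- A maximal exponential inequality of Bernstein type. -/
theorem measure_exists_le_sum_le {Y : ℕ → Ω → ℝ} (hY : ∀ i, Measurable (Y i))
    (hind : iIndepFun Y P) (hY1 : ∀ i ω, |Y i ω| ≤ 1) (hY0 : ∀ i, ∫ ω, Y i ω ∂P = 0) {v : ℝ}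
    (hv : ∀ i, ∫ ω, Y i ω ^ 2 ∂P ≤ v) {c : ℝ} (hc0 : 0 ≤ c) (hc1 : c ≤ 1) (N : ℕ) (x : ℝ) :
    P {ω | ∃ n ≤ N, x ≤ ∑ i ∈ Finset.range n, Y i ω} ≤
      ENNReal.ofReal (Real.exp (-(c * x) + c ^ 2 * v * N)) := by
  have hv0 : 0 ≤ v := (integral_nonneg fun ω => sq_nonneg (Y 0 ω)).trans (hv 0)
  -- For x ≤ 0 the bound is at least 1. Once x > 0, the empty sum at n = 0 cannot reach x.
  rcases le_or_gt x 0 with hx | hx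
  · refine prob_le_one.trans (ENNReal.one_le_ofReal.2 (Real.one_le_exp ?_))
    have : 0 ≤ c ^ 2 * v * N := by positivity
    nlinarith
  rcases Nat.eq_zero_or_pos N with rfl | hN
  · have : {ω | ∃ n ≤ 0, x ≤ ∑ i ∈ Finset.range n, Y i ω} = ∅ := by
      ext ω; simp [hx]
    rw [this, measure_empty]; exact zero_le
  obtain ⟨M, rfl⟩ := Nat.exists_eq_succ_of_ne_zero hN.ne'
  have hsub := submartingale_exp_sum hY hind hY1 hY0 c
  set f : ℕ → Ω → ℝ := fun n ω => Real.exp (c * ∑ i ∈ Finset.range (n + 1), Y i ω)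
  have hmax := maximal_ineq hsub (fun n ω => (Real.exp_pos _).le)
    (ε := ⟨Real.exp (c * x), (Real.exp_pos _).le⟩) M
  set S := {ω | Real.exp (c * x) ≤
    (Finset.range (M + 1)).sup' Finset.nonempty_range_add_one fun k => f k ω}
  have hSsub : {ω | ∃ n ≤ M.succ, x ≤ ∑ i ∈ Finset.range n, Y i ω} ⊆ S := by
    rintro ω ⟨n, hn, hxn⟩
    obtain ⟨m, rfl⟩ : ∃ m, n = m + 1 := by
      refine Nat.exists_eq_succ_of_ne_zero ?_
      rintro rfl
      simp at hxn; linarith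
    have h1 : Real.exp (c * x) ≤ f m ω := Real.exp_le_exp.2 (mul_le_mul_of_nonneg_left hxn hc0)
    exact h1.trans (Finset.le_sup' (fun k => f k ω) (Finset.mem_range.2 hn))
  have hmean : ∫ ω, f M ω ∂P ≤ Real.exp (c ^ 2 * v * (M + 1 : ℕ)) := by
    have h1 := hind.mgf_sum (t := c) hY (Finset.range (M + 1))
    have h2 : ∫ ω, f M ω ∂P = mgf (∑ i ∈ Finset.range (M + 1), Y i) P c := by
      simp [mgf, f]
    rw [h2, h1]
    calc _ ≤ ∏ _i ∈ Finset.range (M + 1), Real.exp (c ^ 2 * v) :=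
          Finset.prod_le_prod (fun i _ => mgf_nonneg) fun i _ =>
            mgf_le_of_abs_le_one (hY i) (hY1 i) (hY0 i) (hv i) (by rwa [abs_of_nonneg hc0])
      _ = _ := by
          rw [Finset.prod_const, Finset.card_range, ← Real.exp_nat_mul]; congr 1; ring
  have hset : ∫ ω in S, f M ω ∂P ≤ ∫ ω, f M ω ∂P :=
    setIntegral_le_integral (hsub.integrable M) (ae_of_all _ fun ω => (Real.exp_pos _).le)
  have h3 : ENNReal.ofReal (Real.exp (c * x)) * P S ≤
      ENNReal.ofReal (Real.exp (c ^ 2 * v * (M + 1 : ℕ))) := by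
    refine le_trans (le_of_eq ?_) (hmax.trans (ENNReal.ofReal_le_ofReal (hset.trans hmean)))
    congr 1
    exact ENNReal.ofReal_eq_coe_nnreal (Real.exp_pos _).le
  refine (measure_mono hSsub).trans ?_
  rw [Real.exp_add, Real.exp_neg, ENNReal.ofReal_mul (by positivity),
    ENNReal.ofReal_inv_of_pos (Real.exp_pos _)]
  rw [← ENNReal.div_eq_inv_mul, ENNReal.le_div_iff_mul_le (by simp [Real.exp_pos]) (by simp), mul_comm]
  exact h3

end MaximalInequality

/-! ### Dyadic chaining and the iterated logarithm for uniform samples -/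

/-- The centred number of points among `x 0, …, x (n - 1)` in `(-∞, u]`, for points that are
uniformly distributed on the unit interval. -/
def centredCount (x : ℕ → ℝ) (n : ℕ) (u : ℝ) : ℝ :=
  ∑ i ∈ Finset.range n, ((Set.Iic u).indicator (fun _ => (1 : ℝ)) (x i) - u)

section Deterministic

variable {x : ℕ → ℝ} {n : ℕ}

/-- The count is increasing in u, so only the linear drift can lower the centred count. This
transfers bounds from a grid to all u. -/
lemma centredCount_le {u b : ℝ} (hub : u ≤ b) :
    centredCount x n u ≤ centredCount x n b + n * (b - u) := by
  have h : ∀ i, (Set.Iic u).indicator (fun _ => (1 : ℝ)) (x i) - u ≤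
      ((Set.Iic b).indicator (fun _ => (1 : ℝ)) (x i) - b) + (b - u) := fun i => by
    have := Set.indicator_le_indicator_of_subset (Set.Iic_subset_Iic.2 hub)
      (f := fun _ => (1 : ℝ)) (fun _ => zero_le_one) (x i)
    linarith
  calc _ ≤ ∑ i ∈ Finset.range n, (((Set.Iic b).indicator (fun _ => (1 : ℝ)) (x i) - b) + (b - u)) :=
        Finset.sum_le_sum fun i _ => h i
    _ = _ := by rw [Finset.sum_add_distrib]; simp [centredCount]; ring

lemma centredCount_sub {a b : ℝ} (hab : a ≤ b) :
    centredCount x n b - centredCount x n a =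
      ∑ i ∈ Finset.range n, ((Set.Ioc a b).indicator (fun _ => (1 : ℝ)) (x i) - (b - a)) := by
  rw [centredCount, centredCount, ← Finset.sum_sub_distrib]
  refine Finset.sum_congr rfl fun i _ => ?_
  simp only [Set.indicator_apply, Set.mem_Iic, Set.mem_Ioc]
  by_cases h1 : x i ≤ a
  · simp [h1, h1.trans hab, not_lt.2 h1]
  · by_cases h2 : x i ≤ b
    · simp [h1, h2, not_le.1 h1]; ring
    · simp [h1, h2]; ring

lemma centredCount_zero (hx : ∀ i, 0 < x i) : centredCount x n 0 = 0 := by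
  refine Finset.sum_eq_zero fun i _ => ?_
  simp [not_le.2 (hx i)]

/-- Chaining along dyadic rationals. -/
lemma abs_centredCount_dyadic_le (hx : ∀ i, 0 < x i) {y : ℕ → ℝ} (hy : ∀ j, 0 ≤ y j) (J : ℕ)
    (h : ∀ j ≤ J, ∀ m < 2 ^ j,
      |centredCount x n ((m + 1 : ℕ) / 2 ^ j) - centredCount x n ((m : ℕ) / 2 ^ j)| ≤ y j)
    {m : ℕ} (hm : m ≤ 2 ^ J) :
    |centredCount x n ((m : ℕ) / 2 ^ J)| ≤ ∑ j ∈ Finset.range (J + 1), y j := by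
  induction J generalizing m with
  | zero =>
    have h1 : m = 0 ∨ m = 1 := by simp at hm; omega
    rcases h1 with rfl | rfl
    · simpa [centredCount_zero hx] using hy 0
    · simpa [centredCount_zero hx] using h 0 le_rfl 0 (by simp)
  | succ J ih =>
    have ih' := fun {m : ℕ} (hm : m ≤ 2 ^ J) => ih (fun j hj => h j (hj.trans (Nat.le_succ J))) hm
    rw [Finset.sum_range_succ]
    have hdiv : ∀ k : ℕ, ((2 * k : ℕ) : ℝ) / 2 ^ (J + 1) = (k : ℕ) / 2 ^ J := fun k => by
      push_cast; rw [pow_succ']; field_simp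
    -- An even grid point lies on the coarser grid; an odd one is a single increment of level J + 1
    -- away from it.
    rcases Nat.even_or_odd' m with ⟨k, rfl | rfl⟩
    · rw [hdiv]
      have := ih' (m := k) (by rw [pow_succ'] at hm; omega)
      linarith [hy (J + 1)]
    · have h1 := h (J + 1) le_rfl (2 * k) (by omega)
      rw [hdiv k] at h1
      have h2 := ih' (m := k) (by rw [pow_succ'] at hm; omega)
      have h3 := abs_add_le (centredCount x n ((2 * k + 1 : ℕ) / 2 ^ (J + 1)) -
        centredCount x n ((k : ℕ) / 2 ^ J)) (centredCount x n ((k : ℕ) / 2 ^ J))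
      rw [sub_add_cancel] at h3
      linarith

lemma abs_centredCount_le (hx : ∀ i, 0 < x i) {y : ℕ → ℝ} (hy : ∀ j, 0 ≤ y j) (J : ℕ)
    (h : ∀ j ≤ J, ∀ m < 2 ^ j,
      |centredCount x n ((m + 1 : ℕ) / 2 ^ j) - centredCount x n ((m : ℕ) / 2 ^ j)| ≤ y j)
    {u : ℝ} (hu0 : 0 ≤ u) (hu1 : u ≤ 1) :
    |centredCount x n u| ≤ ∑ j ∈ Finset.range (J + 1), y j + n / 2 ^ J := by
  have hgrid := fun {m : ℕ} (hm : m ≤ 2 ^ J) => abs_centredCount_dyadic_le hx hy J h hm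
  have hp : (0 : ℝ) < 2 ^ J := by positivity
  rcases hu1.eq_or_lt with rfl | hu1
  · have := hgrid le_rfl
    rw [Nat.cast_pow, Nat.cast_ofNat, div_self hp.ne'] at this
    have : (0 : ℝ) ≤ n / 2 ^ J := by positivity
    linarith
  · set m := ⌊2 ^ J * u⌋₊
    have hm1 : (m : ℝ) ≤ 2 ^ J * u := Nat.floor_le (by positivity)
    have hm2 : 2 ^ J * u < m + 1 := Nat.lt_floor_add_one _
    have hm3 : m < 2 ^ J := by
      have : (m : ℝ) < 2 ^ J := hm1.trans_lt (mul_lt_of_lt_one_right hp hu1)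
      exact_mod_cast this
    have ha : (m : ℝ) / 2 ^ J ≤ u := (div_le_iff₀' hp).2 hm1
    have hb : u ≤ (m + 1 : ℕ) / 2 ^ J := (le_div_iff₀' hp).2 (by push_cast; exact hm2.le)
    have h1 := centredCount_le (x := x) (n := n) ha
    have h2 := centredCount_le (x := x) (n := n) hb
    have h3 := abs_le.1 (hgrid hm3.le)
    have h4 := abs_le.1 (hgrid (m := m + 1) hm3)
    have hlen : ((m + 1 : ℕ) : ℝ) / 2 ^ J = m / 2 ^ J + 1 / 2 ^ J := by push_cast; ring
    have h5 : (n : ℝ) * (u - m / 2 ^ J) ≤ n / 2 ^ J := by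
      calc _ ≤ (n : ℝ) * (1 / 2 ^ J) := by gcongr; linarith
        _ = _ := by ring
    have h6 : (n : ℝ) * ((m + 1 : ℕ) / 2 ^ J - u) ≤ n / 2 ^ J := by
      calc _ ≤ (n : ℝ) * (1 / 2 ^ J) := by gcongr; linarith
        _ = _ := by ring
    exact abs_le.2 ⟨by linarith, by linarith⟩

end Deterministic

section Uniform

variable {Ω : Type*} [MeasurableSpace Ω] {P : Measure Ω} [IsProbabilityMeasure P]

/-- The increment is a sum of centred Bernoulli variables of variance at most b - a. The maximal
inequality is applied to it and to its negative, whence the factor 2. -/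
lemma measure_exists_abs_centredCount_sub_ge {U : ℕ → Ω → ℝ} (hU : ∀ i, Measurable (U i))
    (hind : iIndepFun U P) (hunif : ∀ i, ∀ u, 0 ≤ u → u ≤ 1 → P.real (U i ⁻¹' Set.Iic u) = u)
    {a b : ℝ} (ha : 0 ≤ a) (hab : a ≤ b) (hb : b ≤ 1) {c : ℝ} (hc0 : 0 ≤ c) (hc1 : c ≤ 1)
    (N : ℕ) (z : ℝ) :
    P {ω | ∃ n ≤ N, z ≤ |centredCount (fun i => U i ω) n b - centredCount (fun i => U i ω) n a|} ≤
      2 * ENNReal.ofReal (Real.exp (-(c * z) + c ^ 2 * (b - a) * N)) := by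
  set φ : ℝ → ℝ := fun s => (Set.Ioc a b).indicator (fun _ => (1 : ℝ)) s - (b - a) with hφ
  have hφm : Measurable φ := (measurable_const.indicator measurableSet_Ioc).sub_const _
  have hφ1 : ∀ s, |φ s| ≤ 1 := fun s => by
    rw [hφ, abs_le]
    simp only [Set.indicator_apply]
    split_ifs <;> constructor <;> linarith
  have hpr : ∀ i, P.real (U i ⁻¹' Set.Ioc a b) = b - a := fun i => by
    rw [← Set.Iic_sdiff_Iic, Set.preimage_sdiff, measureReal_sdiff
      (Set.preimage_mono (Set.Iic_subset_Iic.2 hab)) (hU i measurableSet_Iic),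
      hunif i b (ha.trans hab) hb, hunif i a ha (hab.trans hb)]
  have hmeas : ∀ i, MeasurableSet (U i ⁻¹' Set.Ioc a b) := fun i => hU i measurableSet_Ioc
  have hφeq : ∀ i ω, φ (U i ω) = (U i ⁻¹' Set.Ioc a b).indicator (fun _ => (1 : ℝ)) ω - (b - a) :=
    fun i ω => rfl
  have hii : ∀ i, Integrable ((U i ⁻¹' Set.Ioc a b).indicator (fun _ => (1 : ℝ))) P := fun i =>
    (integrable_const _).indicator (hmeas i)
  have hval : ∀ i, ∫ ω, (U i ⁻¹' Set.Ioc a b).indicator (fun _ => (1 : ℝ)) ω ∂P = b - a :=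
    fun i => by rw [integral_indicator_const _ (hmeas i), hpr]; simp
  have hY0 : ∀ i, ∫ ω, φ (U i ω) ∂P = 0 := fun i => by
    simp only [hφeq]
    rw [integral_sub (hii i) (integrable_const _), hval]; simp
  have hv : ∀ i, ∫ ω, φ (U i ω) ^ 2 ∂P ≤ b - a := fun i => by
    have hsq : ∀ ω, φ (U i ω) ^ 2 =
        (1 - 2 * (b - a)) * (U i ⁻¹' Set.Ioc a b).indicator (fun _ => (1 : ℝ)) ω + (b - a) ^ 2 :=
      fun ω => by
        rw [hφeq]
        by_cases hω : ω ∈ U i ⁻¹' Set.Ioc a b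
        · rw [Set.indicator_of_mem hω]; ring
        · rw [Set.indicator_of_notMem hω]; ring
    simp only [hsq]
    rw [integral_add ((hii i).const_mul _) (integrable_const _), integral_const_mul, hval]
    simp
    nlinarith [sq_nonneg (b - a)]
  have hind1 : iIndepFun (fun i ω => φ (U i ω)) P := hind.comp (fun _ => φ) fun _ => hφm
  have hind2 : iIndepFun (fun i ω => -φ (U i ω)) P := hind.comp (fun _ s => -φ s) fun _ => hφm.neg
  have h1 := measure_exists_le_sum_le (fun i => hφm.comp (hU i)) hind1 (fun i ω => hφ1 _) hY0 hv
    hc0 hc1 N z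
  have h2 := measure_exists_le_sum_le (Y := fun i ω => -φ (U i ω)) (fun i => (hφm.comp (hU i)).neg)
    hind2
    (fun i ω => (abs_neg _).trans_le (hφ1 _))
    (fun i => by rw [integral_neg, hY0, neg_zero]) (v := b - a)
    (fun i => by simpa only [neg_sq] using hv i) hc0 hc1 N z
  rw [two_mul]
  refine le_trans ?_ ((measure_union_le _ _).trans (add_le_add h1 h2))
  refine measure_mono ?_
  rintro ω ⟨n, hn, hz⟩
  rw [centredCount_sub hab] at hz
  rcases le_abs.1 hz with hz | hz
  · exact Or.inl ⟨n, hn, hz⟩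
  · refine Or.inr ⟨n, hn, hz.trans_eq ?_⟩
    exact (Finset.sum_neg_distrib _).symm

end Uniform

/-- The bound on the oscillation at the dyadic level `j`, up to the sample size `4 ^ J`. -/
def levelBound (J j : ℕ) : ℝ :=
  2 ^ J * √(Real.log J) * ((3 / 4) ^ j + (2 + 2 * j) * (2 / 3) ^ j)

lemma levelBound_nonneg (J j : ℕ) : 0 ≤ levelBound J j := by
  unfold levelBound; positivity

lemma exists_sum_levelBound_le :
    ∃ A, 0 ≤ A ∧ ∀ J, ∑ j ∈ Finset.range (J + 1), levelBound J j ≤ A * (2 ^ J * √(Real.log J)) := by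
  have hs : Summable fun j : ℕ => ((3 / 4 : ℝ) ^ j + (2 + 2 * j) * (2 / 3) ^ j) := by
    refine (summable_geometric_of_lt_one (by norm_num) (by norm_num)).add ?_
    have h1 : Summable fun j : ℕ => (j : ℝ) ^ 1 * (2 / 3 : ℝ) ^ j :=
      summable_pow_mul_geometric_of_norm_lt_one 1 (by norm_num)
    have h0 : Summable fun j : ℕ => (2 / 3 : ℝ) ^ j :=
      summable_geometric_of_lt_one (by norm_num) (by norm_num)
    refine ((h0.mul_left 2).add (h1.mul_left 2)).congr fun j => ?_
    ring
  refine ⟨∑' j : ℕ, ((3 / 4 : ℝ) ^ j + (2 + 2 * j) * (2 / 3) ^ j),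
    tsum_nonneg fun j => by positivity, fun J => ?_⟩
  simp only [levelBound]
  rw [← Finset.mul_sum, mul_comm]
  gcongr
  exact hs.sum_le_tsum _ fun j _ => by positivity

section Uniform

variable {Ω : Type*} [MeasurableSpace Ω] {P : Measure Ω} [IsProbabilityMeasure P]

/-- The event that some increment of the empirical process over a dyadic interval exceeds its
bound at some time up to `4 ^ J`. -/
def oscillationEvent (U : ℕ → Ω → ℝ) (J : ℕ) : Set Ω :=
  ⋃ j ∈ Finset.range (J + 1), ⋃ m ∈ Finset.range (2 ^ j),
    {ω | ∃ n ≤ 4 ^ J, levelBound J j ≤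
      |centredCount (fun i => U i ω) n ((m + 1 : ℕ) / 2 ^ j) -
        centredCount (fun i => U i ω) n ((m : ℕ) / 2 ^ j)|}

lemma measure_oscillationEvent_le {U : ℕ → Ω → ℝ} (hU : ∀ i, Measurable (U i))
    (hind : iIndepFun U P) (hunif : ∀ i, ∀ u, 0 ≤ u → u ≤ 1 → P.real (U i ⁻¹' Set.Iic u) = u)
    {J : ℕ} (hJ1 : 1 ≤ Real.log J) (hJ2 : (3 / 2) ^ J * √(Real.log J) ≤ 2 ^ J) :
    P (oscillationEvent U J) ≤ ENNReal.ofReal (4 * ((J : ℝ) ^ 2)⁻¹) := by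
  set L := Real.log J
  have hL0 : 0 < L := one_pos.trans_le hJ1
  have hJ0 : (0 : ℝ) < J := by
    rcases Nat.eq_zero_or_pos J with h | h
    · simp [L, h] at hL0
    · exact_mod_cast h
  have hpiece : ∀ j ∈ Finset.range (J + 1), ∀ m ∈ Finset.range (2 ^ j),
      P {ω | ∃ n ≤ 4 ^ J, levelBound J j ≤
        |centredCount (fun i => U i ω) n ((m + 1 : ℕ) / 2 ^ j) -
          centredCount (fun i => U i ω) n ((m : ℕ) / 2 ^ j)|} ≤
      ENNReal.ofReal (2 * (((J : ℝ) ^ 2)⁻¹ * (1 / 4) ^ j)) := by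
    intro j hj m hm
    have hj : j ≤ J := Nat.lt_succ_iff.1 (Finset.mem_range.1 hj)
    have hm : m + 1 ≤ 2 ^ j := Finset.mem_range.1 hm
    -- With variance 2^-j and 4^J steps, the quadratic term is L (9/8)^j, exactly c times the
    -- (3/4)^j part of `levelBound`. The other part leaves exp(-L (2 + 2j)) ≤ J^-2 4^-j. A base such
    -- as 3/2, between 1 and 2, keeps c ≤ 1 for large J and the level bounds summable in j.
    set c : ℝ := (2 ^ J)⁻¹ * (3 / 2) ^ j * √L with hc
    have hc1 : c ≤ 1 := by
      rw [hc, mul_assoc, inv_mul_le_iff₀ (by positivity), mul_one]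
      refine le_trans ?_ hJ2
      gcongr
      norm_num
    have hlen : ((m + 1 : ℕ) : ℝ) / 2 ^ j - (m : ℕ) / 2 ^ j = (1 / 2) ^ j := by
      push_cast; rw [one_div_pow]; ring
    have hmain := measure_exists_abs_centredCount_sub_ge hU hind hunif
      (a := (m : ℕ) / 2 ^ j) (b := (m + 1 : ℕ) / 2 ^ j) (by positivity)
      (by gcongr; omega) ((div_le_one (by positivity)).2 (by exact_mod_cast hm))
      (c := c) (by positivity) hc1 (4 ^ J) (levelBound J j)
    rw [hlen] at hmain
    refine hmain.trans ?_
    rw [ENNReal.ofReal_mul zero_le_two, ENNReal.ofReal_ofNat]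
    gcongr
    have hsq : √L * √L = L := Real.mul_self_sqrt hL0.le
    have hcz : c * levelBound J j = L * ((9 / 8) ^ j + (2 + 2 * j)) := by
      have e1 : (3 / 2 : ℝ) ^ j * (3 / 4) ^ j = (9 / 8) ^ j := by rw [← mul_pow]; norm_num
      have e2 : (3 / 2 : ℝ) ^ j * (2 / 3) ^ j = 1 := by rw [← mul_pow]; norm_num
      have e3 : ((2 : ℝ) ^ J)⁻¹ * 2 ^ J = 1 := inv_mul_cancel₀ (by positivity)
      calc c * levelBound J j = (((2 : ℝ) ^ J)⁻¹ * 2 ^ J) * (√L * √L) *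
            ((3 / 2 : ℝ) ^ j * (3 / 4) ^ j + (2 + 2 * j) * ((3 / 2 : ℝ) ^ j * (2 / 3) ^ j)) := by
              rw [hc, levelBound]; ring
        _ = _ := by rw [e1, e2, e3, hsq]; ring
    have hcc : c ^ 2 * (1 / 2) ^ j * ((4 ^ J : ℕ) : ℝ) = L * (9 / 8) ^ j := by
      have e1 : ((3 / 2 : ℝ) ^ j) ^ 2 * (1 / 2) ^ j = (9 / 8) ^ j := by
        rw [← pow_mul, mul_comm j 2, pow_mul, ← mul_pow]; norm_num
      have e3 : (((2 : ℝ) ^ J)⁻¹) ^ 2 * 4 ^ J = 1 := by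
        rw [inv_pow, ← pow_mul, mul_comm J 2, pow_mul]; norm_num
      push_cast
      calc c ^ 2 * (1 / 2) ^ j * 4 ^ J = ((((2 : ℝ) ^ J)⁻¹) ^ 2 * 4 ^ J) * (√L * √L) *
            (((3 / 2 : ℝ) ^ j) ^ 2 * (1 / 2) ^ j) := by rw [hc]; ring
        _ = _ := by rw [e1, e3, hsq]; ring
    rw [hcz, hcc]
    have hJexp : ((J : ℝ) ^ 2)⁻¹ = Real.exp (-(2 * L)) := by
      rw [Real.exp_neg, two_mul, Real.exp_add, Real.exp_log hJ0, sq]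
    have h4 : Real.exp (-(2 * j : ℝ)) ≤ (1 / 4) ^ j := by
      have : Real.exp (-(2 * j : ℝ)) = Real.exp (-2) ^ j := by
        rw [← Real.exp_nat_mul]; congr 1; ring
      rw [this]
      gcongr
      rw [Real.exp_neg, one_div]
      gcongr
      have h2 : (2 : ℝ) ≤ Real.exp 1 := by linarith [Real.add_one_le_exp 1]
      calc (4 : ℝ) = 2 * 2 := by norm_num
        _ ≤ Real.exp 1 * Real.exp 1 := by gcongr
        _ = Real.exp 2 := by rw [← Real.exp_add]; norm_num
    calc Real.exp (-(L * ((9 / 8) ^ j + (2 + 2 * j))) + L * (9 / 8) ^ j)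
        ≤ Real.exp (-(2 * L) + -(2 * j)) := by
          refine Real.exp_le_exp.2 ?_
          have : (j : ℝ) ≤ L * j := le_mul_of_one_le_left (Nat.cast_nonneg j) hJ1
          nlinarith
      _ = Real.exp (-(2 * L)) * Real.exp (-(2 * j : ℝ)) := Real.exp_add _ _
      _ ≤ _ := by rw [hJexp]; gcongr
  -- The 2^j intervals of level j turn 4^-j into 2^-j, still summable.
  have hsum : ∀ j ∈ Finset.range (J + 1), P (⋃ m ∈ Finset.range (2 ^ j),
      {ω | ∃ n ≤ 4 ^ J, levelBound J j ≤
        |centredCount (fun i => U i ω) n ((m + 1 : ℕ) / 2 ^ j) -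
          centredCount (fun i => U i ω) n ((m : ℕ) / 2 ^ j)|}) ≤
      ENNReal.ofReal (2 * ((J : ℝ) ^ 2)⁻¹ * (1 / 2) ^ j) := by
    intro j hj
    refine (measure_biUnion_finset_le _ _).trans ((Finset.sum_le_sum (hpiece j hj)).trans ?_)
    rw [Finset.sum_const, Finset.card_range, nsmul_eq_mul,
      ← ENNReal.ofReal_natCast, ← ENNReal.ofReal_mul (Nat.cast_nonneg _)]
    refine ENNReal.ofReal_le_ofReal (le_of_eq ?_)
    push_cast
    have : (2 : ℝ) ^ j * (1 / 4) ^ j = (1 / 2) ^ j := by rw [← mul_pow]; norm_num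
    rw [← this]; ring
  refine (measure_biUnion_finset_le _ _).trans ((Finset.sum_le_sum hsum).trans ?_)
  rw [← ENNReal.ofReal_sum_of_nonneg fun j _ => by positivity]
  refine ENNReal.ofReal_le_ofReal ?_
  rw [← Finset.mul_sum]
  have hgeo : ∑ j ∈ Finset.range (J + 1), (1 / 2 : ℝ) ^ j ≤ 2 := by
    exact (summable_geometric_two.sum_le_tsum _ fun j _ => by positivity).trans_eq
      tsum_geometric_two
  calc _ ≤ 2 * ((J : ℝ) ^ 2)⁻¹ * 2 := by gcongr
    _ = _ := by ring

lemma eventually_pow_mul_sqrt_log_le :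
    ∀ᶠ J : ℕ in atTop, 1 ≤ Real.log J ∧ (3 / 2) ^ J * √(Real.log J) ≤ 2 ^ J := by
  have h1 : ∀ᶠ J : ℕ in atTop, 1 ≤ Real.log J :=
    (Real.tendsto_log_atTop.comp tendsto_natCast_atTop_atTop).eventually_ge_atTop 1
  have h2 : ∀ᶠ J : ℕ in atTop, (J : ℝ) * (3 / 4) ^ J < 1 :=
    (tendsto_self_mul_const_pow_of_lt_one (by norm_num) (by norm_num)).eventually_lt_const one_pos
  filter_upwards [h1, h2] with J hJ1 hJ2
  refine ⟨hJ1, ?_⟩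
  have h3 : √(Real.log J) ≤ J := by
    calc √(Real.log J) ≤ Real.log J := Real.sqrt_le_self_iff.2 (Or.inr hJ1)
      _ ≤ J := Real.log_le_self (Nat.cast_nonneg _)
  calc _ ≤ (3 / 2 : ℝ) ^ J * J := by gcongr
    _ = 2 ^ J * (J * (3 / 4) ^ J) := by
        have : (3 / 2 : ℝ) ^ J = 2 ^ J * (3 / 4) ^ J := by rw [← mul_pow]; norm_num
        rw [this]; ring
    _ ≤ 2 ^ J * 1 := by gcongr
    _ = _ := mul_one _

/-- Borel–Cantelli with the summable bounds 4 / J²; the shift by J₀ skips the small J for which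
these bounds are not established. -/
lemma ae_eventually_notMem_oscillationEvent {U : ℕ → Ω → ℝ} (hU : ∀ i, Measurable (U i))
    (hind : iIndepFun U P) (hunif : ∀ i, ∀ u, 0 ≤ u → u ≤ 1 → P.real (U i ⁻¹' Set.Iic u) = u) :
    ∀ᵐ ω ∂P, ∀ᶠ J in atTop, ω ∉ oscillationEvent U J := by
  obtain ⟨J₀, hJ₀⟩ := eventually_atTop.1 eventually_pow_mul_sqrt_log_le
  have hsum : ∑' J, P (oscillationEvent U (J + J₀)) ≠ ⊤ := by
    have hs : Summable fun J : ℕ => 4 * (((J + J₀ : ℕ) : ℝ) ^ 2)⁻¹ :=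
      ((summable_nat_add_iff (f := fun J : ℕ => (((J : ℕ) : ℝ) ^ 2)⁻¹) J₀).2
        (Real.summable_nat_pow_inv.2 one_lt_two)).mul_left 4
    refine ne_top_of_le_ne_top hs.tsum_ofReal_ne_top (ENNReal.tsum_le_tsum fun J => ?_)
    obtain ⟨h1, h2⟩ := hJ₀ (J + J₀) (Nat.le_add_left _ _)
    exact measure_oscillationEvent_le hU hind hunif h1 h2
  filter_upwards [ae_eventually_notMem hsum] with ω hω
  obtain ⟨m, hm⟩ := eventually_atTop.1 hω
  refine eventually_atTop.2 ⟨m + J₀, fun J hJ => ?_⟩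
  have := hm (J - J₀) (by omega)
  rwa [Nat.sub_add_cancel (by omega)] at this

end Uniform

/-- Take J = k + 1 with 4^k ≤ n < 4^(k+1), so 2^J ≤ 2√n. The offset 4 ensures k ≥ 4, hence k + 1 ≤
(5/4) k ≤ k log 4 ≤ log n and log J ≤ log log n. -/
lemma eventually_exists_dyadic_scale (J₀ : ℕ) :
    ∀ᶠ n : ℕ in atTop, ∃ J ≥ J₀, n ≤ 4 ^ J ∧
      2 ^ J * √(Real.log J) ≤ 2 * √(n * Real.log (Real.log n)) := by
  filter_upwards [eventually_ge_atTop (4 ^ (J₀ + 4))] with n hn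
  have hn0 : n ≠ 0 := (lt_of_lt_of_le (by positivity) hn).ne'
  set k := Nat.log 4 n with hk
  have hk1 : 4 ^ k ≤ n := Nat.pow_log_le_self 4 hn0
  have hk2 : n < 4 ^ (k + 1) := Nat.lt_pow_succ_log_self (by norm_num) n
  have hk3 : J₀ + 4 ≤ k := Nat.le_log_of_pow_le (by norm_num) hn
  have hk1' : (4 : ℝ) ^ k ≤ n := by exact_mod_cast hk1
  refine ⟨k + 1, by omega, hk2.le, ?_⟩
  have hlog4 : (5 / 4 : ℝ) ≤ Real.log 4 := by
    have : Real.log 4 = 2 * Real.log 2 := by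
      rw [show (4 : ℝ) = 2 ^ 2 by norm_num, Real.log_pow]; norm_num
    rw [this]; linarith [Real.log_two_gt_d9]
  have hk4 : (4 : ℝ) ≤ k := by exact_mod_cast (by omega : 4 ≤ k)
  have hlogn : ((k + 1 : ℕ) : ℝ) ≤ Real.log n := by
    calc ((k + 1 : ℕ) : ℝ) ≤ k * Real.log 4 := by push_cast; nlinarith
      _ = Real.log (4 ^ k) := (Real.log_pow _ _).symm
      _ ≤ _ := Real.log_le_log (by positivity) hk1'
  have hll : Real.log ((k + 1 : ℕ) : ℝ) ≤ Real.log (Real.log n) :=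
    Real.log_le_log (by positivity) hlogn
  rw [Real.sqrt_mul (Nat.cast_nonneg n), ← mul_assoc]
  have h2 : (2 : ℝ) ^ k ≤ √n := by
    refine Real.le_sqrt_of_sq_le ?_
    rw [← pow_mul, mul_comm k 2, pow_mul]; norm_num; exact hk1'
  rw [pow_succ']
  gcongr

section Uniform

variable {Ω : Type*} [MeasurableSpace Ω] {P : Measure Ω} [IsProbabilityMeasure P]

/-- A law of the iterated logarithm for the uniform empirical process (upper bound, up to a
constant factor). -/
theorem exists_ae_eventually_abs_centredCount_le {U : ℕ → Ω → ℝ} (hU : ∀ i, Measurable (U i))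
    (hind : iIndepFun U P) (hunif : ∀ i, ∀ u, 0 ≤ u → u ≤ 1 → P.real (U i ⁻¹' Set.Iic u) = u) :
    ∃ C, ∀ᵐ ω ∂P, ∀ᶠ n : ℕ in atTop, ∀ u, 0 ≤ u → u ≤ 1 →
      |centredCount (fun i => U i ω) n u| ≤ C * √(n * Real.log (Real.log n)) := by
  obtain ⟨A, hA0, hA⟩ := exists_sum_levelBound_le
  refine ⟨(A + 1) * 2, ?_⟩
  have hpos : ∀ᵐ ω ∂P, ∀ i, 0 < U i ω := by
    refine ae_all_iff.2 fun i => ?_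
    have h0 := hunif i 0 le_rfl zero_le_one
    rw [measureReal_eq_zero_iff] at h0
    refine measure_mono_null (fun ω hω => ?_) h0
    exact not_lt.1 (show ¬0 < U i ω from hω)
  filter_upwards [hpos, ae_eventually_notMem_oscillationEvent hU hind hunif] with ω hω hev
  obtain ⟨J₀, hJ₀⟩ := eventually_atTop.1 (hev.and eventually_pow_mul_sqrt_log_le)
  filter_upwards [eventually_exists_dyadic_scale J₀] with n hn u hu0 hu1
  obtain ⟨J, hJ, hnJ, hle⟩ := hn
  obtain ⟨hosc, hlogJ, -⟩ := hJ₀ J hJ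
  simp only [oscillationEvent, Set.mem_iUnion, Set.mem_ofPred_eq, Finset.mem_range, not_exists,
    not_and, not_le] at hosc
  have hchain := abs_centredCount_le hω (levelBound_nonneg J) J
    (fun j hj m hm => (hosc j (Nat.lt_succ_of_le hj) m hm n hnJ).le) hu0 hu1
  -- Since n ≤ 4^J, stopping the chain at level J costs no more than the main term.
  have hn2 : (n : ℝ) / 2 ^ J ≤ 2 ^ J * √(Real.log J) := by
    rw [div_le_iff₀ (by positivity)]
    have h1 : (n : ℝ) ≤ 4 ^ J := by exact_mod_cast hnJ
    have h2 : (4 : ℝ) ^ J = 2 ^ J * 2 ^ J := by rw [← mul_pow]; norm_num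
    have h3 : 1 ≤ √(Real.log J) := Real.one_le_sqrt.2 hlogJ
    calc (n : ℝ) ≤ 2 ^ J * 1 * 2 ^ J := by rw [mul_one, ← h2]; exact h1
      _ ≤ _ := by gcongr
  calc _ ≤ A * (2 ^ J * √(Real.log J)) + 2 ^ J * √(Real.log J) :=
        hchain.trans (add_le_add (hA J) hn2)
    _ = (A + 1) * (2 ^ J * √(Real.log J)) := by ring
    _ ≤ (A + 1) * (2 * √(n * Real.log (Real.log n))) := by gcongr
    _ = _ := by ring

end Uniform

/-! ### Transfer to the empirical distribution function -/

section EmpiricalCDF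

/-- F may have flat pieces: x ≤ t gives F x ≤ F t, but not conversely. The lower bound therefore
uses levels v < F t, for which F x ≤ v does force x ≤ t. -/
lemma abs_empiricalCDF_sub_le {F : ℝ → ℝ} (hF : IsContinuousCDF F) {x : ℕ → ℝ} {n : ℕ}
    (hn : n ≠ 0) {B : ℝ}
    (hB : ∀ u, 0 ≤ u → u ≤ 1 → |centredCount (fun i => F (x i)) n u| ≤ B) (t : ℝ) :
    |empiricalCDF x n t - F t| ≤ B / n := by
  have hn0 : (0 : ℝ) < n := by positivity
  set S := ∑ i ∈ Finset.range n, (Set.Iic t).indicator (fun _ => (1 : ℝ)) (x i)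
  have hS : empiricalCDF x n t = S / n := by rw [empiricalCDF, div_eq_inv_mul]
  have hcount : ∀ u, centredCount (fun i => F (x i)) n u =
      ∑ i ∈ Finset.range n, (Set.Iic u).indicator (fun _ => (1 : ℝ)) (F (x i)) - n * u := fun u => by
    rw [centredCount, Finset.sum_sub_distrib]; simp
  have hup : S ≤ n * F t + B := by
    have h1 := (abs_le.1 (hB (F t) (hF.nonneg t) (hF.le_one t))).2
    rw [hcount] at h1
    have h2 : S ≤ ∑ i ∈ Finset.range n, (Set.Iic (F t)).indicator (fun _ => (1 : ℝ)) (F (x i)) := by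
      refine Finset.sum_le_sum fun i _ => ?_
      by_cases hi : x i ≤ t
      · simp [hi, hF.monotone hi]
      · rw [Set.indicator_of_notMem (by simpa using hi)]
        exact Set.indicator_nonneg (fun _ _ => zero_le_one) _
    linarith
  have hlo : n * F t - B ≤ S := by
    by_contra! hcon
    have hB0 : 0 ≤ B := (abs_nonneg _).trans (hB 0 le_rfl zero_le_one)
    have hS0 : 0 ≤ S := Finset.sum_nonneg fun i _ => Set.indicator_nonneg (fun _ _ => zero_le_one) _
    obtain ⟨v, hv1, hv2⟩ := exists_between
      (show (S + B) / n < F t by rw [div_lt_iff₀ hn0]; linarith)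
    rw [div_lt_iff₀ hn0] at hv1
    have hv0 : 0 ≤ v := by
      by_contra! h
      nlinarith
    have h1 := (abs_le.1 (hB v hv0 (hv2.le.trans (hF.le_one t)))).1
    rw [hcount] at h1
    have h2 : ∑ i ∈ Finset.range n, (Set.Iic v).indicator (fun _ => (1 : ℝ)) (F (x i)) ≤ S := by
      refine Finset.sum_le_sum fun i _ => ?_
      by_cases hi : F (x i) ≤ v
      · have : x i ≤ t := (hF.monotone.reflect_lt (hi.trans_lt hv2)).le
        simp [hi, this]
      · rw [Set.indicator_of_notMem (by simpa using hi)]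
        exact Set.indicator_nonneg (fun _ _ => zero_le_one) _
    linarith
  rw [hS, abs_le]
  constructor
  · have : F t - B / n ≤ S / n := by
      rw [le_div_iff₀ hn0, sub_mul, div_mul_cancel₀ _ hn0.ne']; linarith
    linarith
  · have : S / n ≤ F t + B / n := by
      rw [div_le_iff₀ hn0, add_mul, div_mul_cancel₀ _ hn0.ne']; linarith
    linarith

variable {Ω : Type*} [MeasurableSpace Ω] {P : Measure Ω} [IsProbabilityMeasure P]

/-- The probability integral transform. -/
lemma IsContinuousCDF.measureReal_comp_preimage_Iic {F : ℝ → ℝ} (hF : IsContinuousCDF F)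
    {X : Ω → ℝ} (hX : ∀ t, P.real (X ⁻¹' Set.Iic t) = F t) {u : ℝ} (hu0 : 0 ≤ u)
    (hu1 : u ≤ 1) : P.real ((fun ω => F (X ω)) ⁻¹' Set.Iic u) = u := by
  have hsurj : ∀ v, 0 < v → v < 1 → ∃ t, F t = v := fun v hv0 hv1 =>
    mem_range_of_exists_le_of_exists_ge hF.continuous
      ((hF.tendsto_atBot.eventually_le_const hv0).exists)
      ((hF.tendsto_atTop.eventually_const_le hv1).exists)
  refine le_antisymm ?_ ?_
  -- If F is flat at height u, then F X ≤ u does not give X ≤ t when F t = u; levels v > u avoid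
  -- this.
  · refine le_of_forall_gt_imp_ge_of_dense fun v hv => ?_
    rcases lt_or_ge v 1 with hv1 | hv1
    · obtain ⟨t, rfl⟩ := hsurj v (hu0.trans_lt hv) hv1
      rw [← hX t]
      refine measureReal_mono fun ω hω => ?_
      exact (hF.monotone.reflect_lt (lt_of_le_of_lt hω hv)).le
    · exact measureReal_le_one.trans hv1
  · rcases hu0.eq_or_lt with rfl | hu0
    · exact measureReal_nonneg
    rcases hu1.eq_or_lt with rfl | hu1
    · have : (fun ω => F (X ω)) ⁻¹' Set.Iic 1 = Set.univ :=
        Set.eq_univ_of_forall fun ω => hF.le_one _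
      rw [this, probReal_univ]
    · obtain ⟨t, rfl⟩ := hsurj u hu0 hu1
      conv_lhs => rw [← hX t]
      exact measureReal_mono fun ω hω => hF.monotone hω

/-- A law of the iterated logarithm for the empirical distribution function (upper bound, up to a
constant factor). -/
theorem exists_ae_eventually_abs_empiricalCDF_sub_le {F : ℝ → ℝ} (hF : IsContinuousCDF F)
    {X : ℕ → Ω → ℝ} (hXm : ∀ i, Measurable (X i)) (hind : iIndepFun X P)
    (hX : ∀ i t, P.real (X i ⁻¹' Set.Iic t) = F t) :
    ∃ C, 0 ≤ C ∧ ∀ᵐ ω ∂P, ∀ᶠ n : ℕ in atTop, ∀ t,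
      |empiricalCDF (fun i => X i ω) n t - F t| ≤ C * √(Real.log (Real.log n) / n) := by
  obtain ⟨C, hC⟩ := exists_ae_eventually_abs_centredCount_le
    (fun i => hF.continuous.measurable.comp (hXm i))
    (hind.comp (fun _ => F) fun _ => hF.continuous.measurable)
    (fun i u hu0 hu1 => hF.measureReal_comp_preimage_Iic (hX i) hu0 hu1)
  refine ⟨max C 0, le_max_right _ _, ?_⟩
  filter_upwards [hC] with ω hω
  filter_upwards [hω, eventually_ne_atTop 0] with n hn hn0 t
  refine (abs_empiricalCDF_sub_le hF hn0 hn t).trans ?_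
  have hnpos : (0 : ℝ) < n := by positivity
  have : √(n * Real.log (Real.log n)) / n = √(Real.log (Real.log n) / n) := by
    rw [show Real.log (Real.log n) / n = n * Real.log (Real.log n) / (n : ℝ) ^ 2 by field_simp,
      Real.sqrt_div' _ (by positivity), Real.sqrt_sq hnpos.le]
  rw [mul_div_assoc, this]
  gcongr
  exact le_max_left _ _

end EmpiricalCDF

/-! ### Discrepancy distances and discrepancy bandwidths -/

section Distance

/-- Every discrepancy distance dominates the pointwise difference of bounded functions that vanish
at `-∞`. -/
lemma IsDiscrepancyDist.abs_sub_le {d : (ℝ → ℝ) → (ℝ → ℝ) → ℝ} (hd : IsDiscrepancyDist d)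
    {G H : ℝ → ℝ} {M : ℝ} (hM : ∀ t, |G t - H t| ≤ M)
    (h0 : Tendsto (fun t => G t - H t) atBot (𝓝 0)) (t : ℝ) : |G t - H t| ≤ d G H := by
  rcases hd with rfl | ⟨k, hk, rfl⟩
  · exact le_ciSup (f := fun t => |G t - H t|) ⟨M, by rintro _ ⟨t, rfl⟩; exact hM t⟩ t
  · have hbdd : BddAbove {r : ℝ | ∃ a b : Fin k → ℝ, (∀ i, a i ≤ b i) ∧
        (∀ i j, i < j → b i ≤ a j) ∧ r = ∑ i, |(G (b i) - G (a i)) - (H (b i) - H (a i))|} := by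
      refine ⟨∑ _i : Fin k, (M + M), ?_⟩
      rintro _ ⟨a, b, -, -, rfl⟩
      refine Finset.sum_le_sum fun i _ => ?_
      rw [show G (b i) - G (a i) - (H (b i) - H (a i)) =
        (G (b i) - H (b i)) - (G (a i) - H (a i)) by ring]
      exact (abs_sub _ _).trans (add_le_add (hM _) (hM _))
    have hinc : ∀ a ≤ t, |(G t - H t) - (G a - H a)| ≤ kuiperDist k G H := by
      intro a ha
      -- The first interval is [a, t] and all later ones collapse to the point t; then a → -∞.
      let i₀ : Fin k := ⟨0, hk⟩
      have hmem : ∑ i : Fin k, |(G t - G (if i = i₀ then a else t)) -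
          (H t - H (if i = i₀ then a else t))| ≤ kuiperDist k G H := by
        refine le_csSup hbdd ⟨fun i => if i = i₀ then a else t, fun _ => t, fun i => ?_,
          fun i j hij => ?_, rfl⟩
        · dsimp only; split_ifs
          · exact ha
          · exact le_rfl
        · have hj : j ≠ i₀ := fun h => by
            rw [h] at hij
            exact absurd hij (not_lt.2 (Nat.zero_le _))
          simp [hj]
      refine le_trans ?_ hmem
      refine le_trans (le_of_eq ?_) (Finset.single_le_sum (fun i _ => abs_nonneg _)
        (Finset.mem_univ i₀))
      simp only [if_true]
      congr 1; ring
    have hlim : Tendsto (fun a => |(G t - H t) - (G a - H a)|) atBot (𝓝 |G t - H t|) := by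
      simpa using (tendsto_const_nhds.sub h0).abs
    exact le_of_tendsto hlim ((eventually_le_atBot t).mono hinc)

end Distance

section Empirical

variable (x : ℕ → ℝ) (n : ℕ)

lemma abs_empiricalCDF_le_one (t : ℝ) : |empiricalCDF x n t| ≤ 1 := by
  have h0 : ∀ i, 0 ≤ (Set.Iic t).indicator (fun _ => (1 : ℝ)) (x i) := fun i =>
    Set.indicator_nonneg (fun _ _ => zero_le_one) _
  have h1 : ∀ i, (Set.Iic t).indicator (fun _ => (1 : ℝ)) (x i) ≤ 1 := fun i =>
    Set.indicator_le_self' (fun _ _ => zero_le_one) _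
  have hs0 := Finset.sum_nonneg fun i (_ : i ∈ Finset.range n) => h0 i
  have hs1 : ∑ i ∈ Finset.range n, (Set.Iic t).indicator (fun _ => (1 : ℝ)) (x i) ≤ n := by
    simpa using Finset.sum_le_sum fun i (_ : i ∈ Finset.range n) => h1 i
  rw [empiricalCDF, abs_of_nonneg (by positivity)]
  exact inv_mul_le_one_of_le₀ hs1 (Nat.cast_nonneg n)

lemma measurable_empiricalCDF : Measurable (empiricalCDF x n) := by
  refine Measurable.const_mul (Finset.measurable_sum _ fun i _ => ?_) _
  have : (fun t => (Set.Iic t).indicator (fun _ => (1 : ℝ)) (x i)) =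
      (Set.Ici (x i)).indicator fun _ => (1 : ℝ) := by
    ext t; simp [Set.indicator_apply]
  rw [this]
  exact measurable_const.indicator measurableSet_Ici

lemma tendsto_empiricalCDF_atBot : Tendsto (empiricalCDF x n) atBot (𝓝 0) := by
  have h : ∀ᶠ t in atBot, ∀ i ∈ Finset.range n, t < x i :=
    (Finset.eventually_all _).2 fun i _ => eventually_lt_atBot (x i)
  refine tendsto_const_nhds.congr' ?_
  filter_upwards [h] with t ht
  have h0 : ∑ i ∈ Finset.range n, (Set.Iic t).indicator (fun _ => (1 : ℝ)) (x i) = 0 :=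
    Finset.sum_eq_zero fun i hi => Set.indicator_of_notMem
      (show x i ∉ Set.Iic t from not_le.2 (ht i hi)) _
  rw [empiricalCDF, h0, mul_zero]

/-- Substituting u = (v - a) / h turns v ≤ t into a ≤ t - hu, so summing over the sample yields F_n
at shifted points. -/
lemma setIntegral_Iic_comp_div (K : ℝ → ℝ) {h : ℝ} (hh : 0 < h) (a t : ℝ) :
    ∫ v in Set.Iic t, K ((v - a) / h) =
      h * ∫ u, K u * (Set.Iic (t - h * u)).indicator (fun _ => (1 : ℝ)) a := by
  set g : ℝ → ℝ := fun u => K u * (Set.Iic (t - h * u)).indicator (fun _ => (1 : ℝ)) a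
  have h1 : ∀ v, (Set.Iic t).indicator (fun v => K ((v - a) / h)) v = g ((v - a) / h) := fun v => by
    have : t - h * ((v - a) / h) = t - v + a := by field_simp; ring
    simp only [g, this, Set.indicator_apply, Set.mem_Iic, le_add_iff_nonneg_left, sub_nonneg]
    split_ifs <;> simp
  rw [← integral_indicator measurableSet_Iic]
  simp only [h1]
  rw [integral_sub_right_eq_self (fun v => g (v / h)) a, Measure.integral_comp_div, abs_of_pos hh,
    smul_eq_mul]

variable {x n}

lemma integrable_mul_empiricalCDF {K : ℝ → ℝ} (hK : Integrable K) (h t : ℝ) :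
    Integrable fun u => K u * empiricalCDF x n (t - h * u) :=
  hK.mul_bdd (c := 1) ((measurable_empiricalCDF x n).comp (by fun_prop)).aestronglyMeasurable
    (ae_of_all _ fun _ => abs_empiricalCDF_le_one x n _)

/-- The kernel estimator of the distribution function is the smoothed empirical distribution
function. -/
lemma kernelCDFEstimator_eq_integral {K : ℝ → ℝ} (hK : Integrable K) {h : ℝ} (hh : 0 < h) (t : ℝ) :
    kernelCDFEstimator K x n h t = ∫ u, K u * empiricalCDF x n (t - h * u) := by
  have hi : ∀ i, Integrable fun v => K ((v - x i) / h) := fun i =>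
    (hK.comp_div hh.ne').comp_sub_right (x i)
  have hi2 : ∀ i, Integrable fun u =>
      K u * (Set.Iic (t - h * u)).indicator (fun _ => (1 : ℝ)) (x i) := fun i => by
    have hm : Measurable fun u => (Set.Iic (t - h * u)).indicator (fun _ => (1 : ℝ)) (x i) := by
      have : (fun u => (Set.Iic (t - h * u)).indicator (fun _ => (1 : ℝ)) (x i)) =
          (Set.Ici (x i)).indicator (fun _ => (1 : ℝ)) ∘ fun u => t - h * u := by
        ext u; simp [Set.indicator_apply]
      rw [this]
      exact (measurable_const.indicator measurableSet_Ici).comp (by fun_prop)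
    refine hK.mul_bdd (c := 1) hm.aestronglyMeasurable (ae_of_all _ fun u => ?_)
    exact (norm_indicator_le_norm_self _ _).trans (by simp)
  simp only [kernelCDFEstimator, kernelDensityEstimator, empiricalCDF]
  rw [integral_const_mul, integral_finsetSum _ fun i _ => (hi i).integrableOn]
  simp only [setIntegral_Iic_comp_div K hh]
  have : ∀ u, K u * ((n : ℝ)⁻¹ * ∑ i ∈ Finset.range n,
      (Set.Iic (t - h * u)).indicator (fun _ => (1 : ℝ)) (x i)) =
      (n : ℝ)⁻¹ * ∑ i ∈ Finset.range n,
        K u * (Set.Iic (t - h * u)).indicator (fun _ => (1 : ℝ)) (x i) := fun u => by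
    rw [← Finset.mul_sum]; ring
  simp only [this]
  rw [integral_const_mul, integral_finsetSum _ fun i _ => hi2 i, ← Finset.mul_sum, mul_inv,
    mul_assoc, inv_mul_cancel_left₀ hh.ne']

lemma abs_integral_mul_le {K : ℝ → ℝ} (hK : Integrable K) {g : ℝ → ℝ} {r : ℝ}
    (hg : ∀ u, |g u| ≤ r) : |∫ u, K u * g u| ≤ (∫ u, ‖K u‖) * r := by
  rw [← integral_mul_const, ← Real.norm_eq_abs]
  refine norm_integral_le_of_norm_le (hK.norm.mul_const r) (ae_of_all _ fun u => ?_)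
  rw [norm_mul]
  exact mul_le_mul_of_nonneg_left (hg u) (norm_nonneg _)

lemma tendsto_integral_mul_empiricalCDF_atBot {K : ℝ → ℝ} (hK : Integrable K) (h : ℝ) :
    Tendsto (fun t => ∫ u, K u * empiricalCDF x n (t - h * u)) atBot (𝓝 0) := by
  have : (0 : ℝ) = ∫ u, K u * 0 := by simp
  rw [this]
  refine tendsto_integral_filter_of_dominated_convergence (fun u => ‖K u‖)
    (Eventually.of_forall fun t => (integrable_mul_empiricalCDF hK h t).aestronglyMeasurable) ?_
    hK.norm (ae_of_all _ fun u => ?_)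
  · refine Eventually.of_forall fun t => ae_of_all _ fun u => ?_
    rw [norm_mul]
    exact mul_le_of_le_one_right (norm_nonneg _) (abs_empiricalCDF_le_one x n _)
  · exact ((tendsto_empiricalCDF_atBot x n).comp
      (tendsto_atBot_add_const_right _ (-(h * u)) tendsto_id)).const_mul _

lemma IsDiscrepancyBandwidth.abs_empiricalCDF_sub_integral_le {d : (ℝ → ℝ) → (ℝ → ℝ) → ℝ}
    (hd : IsDiscrepancyDist d) {K : ℝ → ℝ} (hK : Integrable K) {τ h : ℝ}
    (hh : IsDiscrepancyBandwidth d K x n τ h) (t : ℝ) :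
    |empiricalCDF x n t - ∫ u, K u * empiricalCDF x n (t - h * u)| ≤ τ := by
  obtain ⟨h0, hτ⟩ := hh
  have heq : kernelCDFEstimator K x n h =
      fun t => ∫ u, K u * empiricalCDF x n (t - h * u) :=
    funext fun t => kernelCDFEstimator_eq_integral hK h0 t
  rw [heq] at hτ
  rw [← hτ]
  refine hd.abs_sub_le (G := empiricalCDF x n)
    (H := fun t => ∫ u, K u * empiricalCDF x n (t - h * u)) (M := 1 + (∫ u, ‖K u‖) * 1) (fun t => ?_) ?_ t
  · exact (abs_sub _ _).trans (add_le_add (abs_empiricalCDF_le_one x n t)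
      (abs_integral_mul_le hK fun u => abs_empiricalCDF_le_one x n _))
  · simpa using (tendsto_empiricalCDF_atBot x n).sub
      (tendsto_integral_mul_empiricalCDF_atBot hK h)

/-- The bias at a bandwidth chosen by the discrepancy principle is controlled by the threshold and
by the error of the empirical distribution function. -/
lemma IsDiscrepancyBandwidth.abs_smoothingBias_le {d : (ℝ → ℝ) → (ℝ → ℝ) → ℝ}
    (hd : IsDiscrepancyDist d) {K F : ℝ → ℝ} (hK : Integrable K) (hF : IsContinuousCDF F) {τ h : ℝ}
    (hh : IsDiscrepancyBandwidth d K x n τ h) {r : ℝ} (hr : ∀ t, |empiricalCDF x n t - F t| ≤ r)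
    (t : ℝ) : |smoothingBias K F h t| ≤ τ + (1 + ∫ u, ‖K u‖) * r := by
  have hFc := hF.continuous
  have h1 := hh.abs_empiricalCDF_sub_integral_le hd hK t
  have h2 := abs_integral_mul_le hK (g := fun u => empiricalCDF x n (t - h * u) - F (t - h * u))
    fun u => hr _
  have hKF : Integrable fun u => K u * F (t - h * u) :=
    hK.mul_bdd (c := 1) (Continuous.aestronglyMeasurable (by fun_prop))
      (ae_of_all _ fun u => hF.norm_le_one _)
  simp only [mul_sub] at h2
  rw [integral_sub (integrable_mul_empiricalCDF hK h t) hKF] at h2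
  have h3 := abs_le.1 h1
  have h4 := abs_le.1 h2
  have h5 := abs_le.1 (hr t)
  rw [smoothingBias, abs_le]
  constructor <;> linarith [h3.1, h3.2, h4.1, h4.2, h5.1, h5.2]

end Empirical

/-! ### Continuity of the law, and comparison of rates -/

section Law

lemma isContinuousCDF_cdf (μ : Measure ℝ) [IsProbabilityMeasure μ] [NullSingletonClass μ] :
    IsContinuousCDF (cdf μ) where
  monotone := monotone_cdf μ
  continuous := by
    refine continuous_iff_continuousAt.2 fun t => ?_
    rw [(monotone_cdf μ).continuousAt_iff_leftLim_eq_rightLim, StieltjesFunction.rightLim_eq]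
    have h := (cdf μ).measure_singleton t
    rw [measure_cdf, measure_singleton, eq_comm, ENNReal.ofReal_eq_zero, sub_nonpos] at h
    exact le_antisymm ((monotone_cdf μ).leftLim_le le_rfl) h
  tendsto_atBot := tendsto_cdf_atBot μ
  tendsto_atTop := tendsto_cdf_atTop μ

end Law

section Rates

lemma tendsto_sqrt_log_log_div :
    Tendsto (fun n : ℕ => √(Real.log (Real.log n) / n)) atTop (𝓝 0) := by
  have h1 : Tendsto (fun x : ℝ => Real.log (Real.log x) / x) atTop (𝓝 0) := by
    have h2 : (fun x : ℝ => Real.log (Real.log x)) =o[atTop] fun x => x :=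
      (Real.isLittleO_log_id_atTop.comp_tendsto Real.tendsto_log_atTop).trans
        Real.isLittleO_log_id_atTop
    exact h2.tendsto_div_nhds_zero
  simpa using (h1.comp tendsto_natCast_atTop_atTop).sqrt

lemma eventually_log_log_nonneg : ∀ᶠ n : ℕ in atTop, 0 ≤ Real.log (Real.log n) :=
  ((Real.tendsto_log_atTop.comp Real.tendsto_log_atTop).comp
    tendsto_natCast_atTop_atTop).eventually_ge_atTop 0

lemma sqrt_div_rpow_inv {a n : ℝ} (ha : 0 ≤ a) (hn : 0 ≤ n) (ℓ : ℕ) :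
    √(a / n) ^ ((ℓ : ℝ)⁻¹) = n ^ (-(1 / (2 * (ℓ : ℝ)))) * a ^ (1 / (2 * (ℓ : ℝ))) := by
  rw [Real.sqrt_eq_rpow, ← Real.rpow_mul (by positivity),
    show 1 / 2 * (ℓ : ℝ)⁻¹ = 1 / (2 * (ℓ : ℝ)) by rw [one_div_mul_eq_div, one_div, mul_inv]; ring,
    Real.div_rpow ha hn, Real.rpow_neg hn, div_eq_inv_mul]

/-- Since 1/(2ℓ) > 1/(2ℓ + 1), a spare positive power of n absorbs the iterated logarithm and the
constant. -/
lemma eventually_rate_le {ℓ : ℕ} (hℓ : 1 ≤ ℓ) (C : ℝ) {ε : ℝ} (hε : 0 < ε) :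
    ∀ᶠ n : ℕ in atTop, C * ((n : ℝ) ^ (-(1 / (2 * (ℓ : ℝ)))) *
      Real.log (Real.log (n : ℝ)) ^ (1 / (2 * (ℓ : ℝ)))) ≤
        ε * (n : ℝ) ^ (-(1 / (2 * (ℓ : ℝ) + 1))) := by
  have hℓ0 : (0 : ℝ) < ℓ := by exact_mod_cast hℓ
  set p : ℝ := 1 / (2 * (ℓ : ℝ)) with hp
  have hp0 : 0 < p := by positivity
  set q : ℝ := p - 1 / (2 * (ℓ : ℝ) + 1) with hq
  have hq0 : 0 < q := sub_pos.2 (one_div_lt_one_div_of_lt (by positivity) (by linarith))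
  have hlo := ((isLittleO_log_rpow_rpow_atTop p hq0).comp_tendsto
    (tendsto_natCast_atTop_atTop (R := ℝ))).bound (div_pos hε (by positivity : 0 < |C| + 1))
  have hlog : ∀ᶠ n : ℕ in atTop, 0 ≤ Real.log n :=
    (Real.tendsto_log_atTop.comp tendsto_natCast_atTop_atTop).eventually_ge_atTop 0
  filter_upwards [hlo, eventually_log_log_nonneg, hlog, eventually_gt_atTop 0] with n h1 h2 h3 hn
  have hn0 : (0 : ℝ) < n := by exact_mod_cast hn
  simp only [Function.comp, Real.norm_eq_abs, Real.abs_rpow_of_nonneg h3,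
    Real.abs_rpow_of_nonneg hn0.le, abs_of_nonneg h3, abs_of_pos hn0] at h1
  have h4 : Real.log (Real.log n) ^ p ≤ Real.log n ^ p :=
    Real.rpow_le_rpow h2 (Real.log_le_self h3) hp0.le
  calc C * ((n : ℝ) ^ (-p) * Real.log (Real.log n) ^ p)
      ≤ (|C| + 1) * ((n : ℝ) ^ (-p) * Real.log (Real.log n) ^ p) := by
        gcongr
        linarith [le_abs_self C]
    _ ≤ (|C| + 1) * ((n : ℝ) ^ (-p) * (ε / (|C| + 1) * (n : ℝ) ^ q)) := by
        gcongr
        exact h4.trans h1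
    _ = ε * ((n : ℝ) ^ (-p) * (n : ℝ) ^ q) := by
        have : |C| + 1 ≠ 0 := by positivity
        field_simp
    _ = _ := by
        rw [← Real.rpow_add hn0]; congr 2; rw [hq]; ring

end Rates

end KernelDiscrepancy

end

theorem mainTheorem6 {Ω : Type*} [MeasurableSpace Ω] (P : Measure Ω) [IsProbabilityMeasure P]
    (X : ℕ → Ω → ℝ) (hXm : ∀ i, Measurable (X i)) (hXindep : iIndepFun X P)
    (f : ℝ → ℝ) (hf_nonneg : ∀ᵐ x, 0 ≤ f x)
    (hXlaw : ∀ i, P.map (X i) = volume.withDensity (fun x => ENNReal.ofReal (f x)))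
    (ℓ : ℕ) (hℓ : 1 ≤ ℓ) (hf : KernelDiscrepancy.MemSobolevL1 ℓ f)
    (K : ℝ → ℝ) (hK : KernelDiscrepancy.IsKernelOfOrder K ℓ)
    (d : (ℝ → ℝ) → (ℝ → ℝ) → ℝ) (hd : KernelDiscrepancy.IsDiscrepancyDist d)
    (s : ℕ → ℝ)
    (hs : s =O[atTop] fun n : ℕ => Real.sqrt (Real.log (Real.log (n : ℝ)) / (n : ℝ))) :
    ∀ᵐ ω ∂P,
      (∃ C : ℝ, ∀ᶠ n : ℕ in atTop, ∀ h : ℝ,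
        KernelDiscrepancy.IsDiscrepancyBandwidth d K (fun i => X i ω) n (s n) h →
          h ≤ C * ((n : ℝ) ^ (-(1 / (2 * (ℓ : ℝ)))) *
            Real.log (Real.log (n : ℝ)) ^ (1 / (2 * (ℓ : ℝ))))) ∧
      (∀ ε : ℝ, 0 < ε → ∀ᶠ n : ℕ in atTop, ∀ h : ℝ,
        KernelDiscrepancy.IsDiscrepancyBandwidth d K (fun i => X i ω) n (s n) h →
          h ≤ ε * (n : ℝ) ^ (-(1 / (2 * (ℓ : ℝ) + 1)))) := by
  have hℓ0 : ℓ ≠ 0 := Nat.one_le_iff_ne_zero.1 hℓ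
  set μ : Measure ℝ := volume.withDensity (fun x => ENNReal.ofReal (f x)) with hμ
  have : IsProbabilityMeasure μ := by
    rw [← hXlaw 0]; exact Measure.isProbabilityMeasure_map (hXm 0).aemeasurable
  have : NullSingletonClass μ :=
    ⟨fun x => withDensity_absolutelyContinuous _ _ (measure_singleton x)⟩
  have hF := KernelDiscrepancy.isContinuousCDF_cdf μ
  have hXF : ∀ i t, P.real (X i ⁻¹' Set.Iic t) = cdf μ t := fun i t => by
    rw [cdf_eq_real, ← hXlaw i, map_measureReal_apply (hXm i) measurableSet_Iic]
  obtain ⟨A, hA0, hA⟩ := KernelDiscrepancy.exists_ae_eventually_abs_empiricalCDF_sub_le hF hXm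
    hXindep hXF
  obtain ⟨c, hc, δ, hδ, hbias⟩ := hK.exists_pow_le_bias hℓ0 hF
  obtain ⟨B, hB0, hB⟩ := hs.exists_pos
  -- B measures the threshold and A the error of F_n, in units of √(log log n / n). Once M times
  -- this unit is below δ, large bandwidths are excluded and c h^ℓ is bounded by it, giving the
  -- constant (M / c)^(1/ℓ).
  set M : ℝ := B + (1 + ∫ u, ‖K u‖) * A with hM
  have hM0 : 0 ≤ M := by positivity
  have hρ : ∀ᶠ n : ℕ in atTop, M * √(Real.log (Real.log n) / n) < δ := by
    have := KernelDiscrepancy.tendsto_sqrt_log_log_div.const_mul M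
    rw [mul_zero] at this
    exact this.eventually_lt_const hδ
  filter_upwards [hA] with ω hω
  have hmain : ∀ᶠ n : ℕ in atTop, ∀ h : ℝ,
      KernelDiscrepancy.IsDiscrepancyBandwidth d K (fun i => X i ω) n (s n) h →
        h ≤ (M / c) ^ ((ℓ : ℝ)⁻¹) * ((n : ℝ) ^ (-(1 / (2 * (ℓ : ℝ)))) *
          Real.log (Real.log (n : ℝ)) ^ (1 / (2 * (ℓ : ℝ)))) := by
    filter_upwards [hω, hρ, hB.bound, KernelDiscrepancy.eventually_log_log_nonneg] with
      n hn hρn hBn hlog h hh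
    have hD : ∀ t, |KernelDiscrepancy.smoothingBias K (cdf μ) h t| ≤
        M * √(Real.log (Real.log n) / n) := fun t => by
      refine (hh.abs_smoothingBias_le hd hK.integrable hF hn t).trans ?_
      rw [Real.norm_eq_abs, Real.norm_of_nonneg (Real.sqrt_nonneg _)] at hBn
      rw [hM]
      linarith [le_abs_self (s n)]
    have hpow := hbias h hh.1 _ hD hρn
    have hle : h ^ ℓ ≤ M / c * √(Real.log (Real.log n) / n) := by
      rw [div_mul_eq_mul_div, le_div_iff₀ hc]; linarith
    rw [← KernelDiscrepancy.sqrt_div_rpow_inv hlog (Nat.cast_nonneg n) ℓ,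
      ← Real.mul_rpow (by positivity) (by positivity)]
    calc h = (h ^ ℓ) ^ ((ℓ : ℝ)⁻¹) := (Real.pow_rpow_inv_natCast hh.1.le hℓ0).symm
      _ ≤ _ := Real.rpow_le_rpow (pow_nonneg hh.1.le _) hle (by positivity)
  refine ⟨⟨_, hmain⟩, fun ε hε => ?_⟩
  filter_upwards [hmain, KernelDiscrepancy.eventually_rate_le hℓ _ hε] with n h1 h2 h hh
  exact (h1 h hh).trans h2
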